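/- Let $K$ be a field, let $v_1,\dots,v_m\in\mathbb{N}^s$ with $m\ge 1$, and let $\mathcal{P}=\mathrm{conv}(v_1,\dots,v_m)\subset\mathbb{R}^s$. Let $w=(w_1,\dots,w_p)\colon\mathbb{R}^s\to\mathbb{R}^p$, where the $w_i$ are linear functions with $w_i(e_j)\in\mathbb{N}$ for all $i,j$ ($e_j$ the standard unit vectors). For a lattice polytope $\mathcal{Q}$ with vertices in $\mathbb{N}^q$ let $A(\mathcal{Q})=K[\{t^az^n : n\ge 0,\ a\in n\mathcal{Q}\cap\mathbb{Z}^q\}]\subset K[t_1,\dots,t_q,z]$ be its Ehrhart ring, and put $$A^w(\mathcal{P})=K[\{y^{w(a)}z^n : n\ge 0,\ a\in n\mathcal{P}\cap\mathbb{Z}^s\}]\subset K[y_1,\dots,y_p,z].$$ Let $B$ be the integer matrix with columns $(w(v_1),1),\dots,(w(v_m),1)$ and let $k=\mathrm{rank}(B)$. Write $\overline{R}$ for the integral closure of a domain $R$ in its field of fractions; the fields of fractions of subrings of $K[y_1,\dots,y_p,z]$ are taken inside $K(y_1,\dots,y_p,z)$. Then the following hold. (a) $A^w(\mathcal{P})=\bigoplus_{n\ge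 0}A^w(\mathcal{P})_n$ is a graded $K$-algebra, where $A^w(\mathcal{P})_n=\sum_{a\in n\mathcal{P}\cap\mathbb{Z}^s}K\,y^{w(a)}z^n$. (b) For all $n\ge 0$, $H(n):=\dim_K A^w(\mathcal{P})_n=|w(n\mathcal{P}\cap\mathbb{Z}^s)|<\infty$. (c) There are finitely many monomials $t^{c_1}z^{d_1},\dots,t^{c_r}z^{d_r}\in A(\mathcal{P})$ such that $A(\mathcal{P})=K[\{t^{c_i}z^{d_i}\}_{i=1}^r]$ and $A^w(\mathcal{P})=K[\{y^{w(c_i)}z^{d_i}\}_{i=1}^r]$. In particular $A^w(\mathcal{P})$ is a finitely generated $K$-algebra. (d) $L:=K[\{y^{w(v_i)}z : i=1,\dots,m\}]\subset A^w(\mathcal{P})$ is a finite integral extension. (e) $\overline{L}\subset\overline{A^w(\mathcal{P})}\subset A(w(\mathcal{P}))$, and both inclusions are equalities if and only if the gcd of all non-zero $k\times k$ minors of $B$ is $1$. (f) Let $D=\dim A^w(\mathcal{P})$ be the Krull dimension. Then $1\le D<\infty$, there is a polynomial $f\in\mathbb{Q}[x]$ of degree $D-1$ with $H(n)=f(n)$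 for all sufficiently large $n$, and there is $h\in\mathbb{Z}[x]$ with $h(1)\neq 0$ such that $$\sum_{n\ge 0}H(n)x^n=\frac{h(x)}{(1-x)^{D}}.$$ -/

import Mathlib

open scoped Pointwise

namespace WeightedEhrhart

/-- The vector of `ℝ^q` with the given natural coordinates. -/
def natVec {q : ℕ} (b : Fin q → ℕ) : Fin q → ℝ := fun i => (b i : ℝ)

/-- The polynomial ring `K[y₁, …, y_q, z]`: the variables `y_i` are `X (some i)`, and `z` is
`X none`. -/
abbrev PolyRing (K : Type*) [Field K] (q : ℕ) : Type _ := MvPolynomial (Option (Fin q)) K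

/-- The monomial `y^b z^n`. -/
noncomputable def yz (K : Type*) [Field K] {q : ℕ} (b : Fin q → ℕ) (n : ℕ) : PolyRing K q :=
  MvPolynomial.monomial (Finsupp.equivFunOnFinite.symm fun o : Option (Fin q) => o.elim n b) 1

/-- `K[{y^x z^n : (x, n) ∈ E}]`, for a set `E` of pairs `(x, n)` with `x` in `ℕ^q ⊆ ℝ^q`. -/
noncomputable def monomialAlgebra (K : Type*) [Field K] {q : ℕ} (E : Set ((Fin q → ℝ) × ℕ)) :
    Subalgebra K (PolyRing K q) :=
  Algebra.adjoin K {f | ∃ (b : Fin q → ℕ) (n : ℕ), (natVec b, n) ∈ E ∧ f = yz K b n}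

/-- The `K`-linear span of the monomials `y^x z^n` with `(x, n) ∈ E`, for a fixed `n`, inside
`K[{y^x z^n : (x, n) ∈ E}]`. -/
noncomputable def monomialPiece (K : Type*) [Field K] {q : ℕ} (E : Set ((Fin q → ℝ) × ℕ))
    (n : ℕ) : Submodule K (monomialAlgebra K E) :=
  Submodule.span K {f | ∃ b : Fin q → ℕ, (natVec b, n) ∈ E ∧ (f : PolyRing K q) = yz K b n}

/-- The set `nP ∩ ℤ^q` of lattice points of the `n`-th dilate of `P`. -/
def latticePoints {q : ℕ} (P : Set (Fin q → ℝ)) (n : ℕ) : Set (Fin q → ℝ) :=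
  {x | x ∈ (n : ℝ) • P ∧ ∀ i, ∃ k : ℤ, x i = (k : ℝ)}

/-- The pairs `(a, n)` with `a ∈ nP ∩ ℤ^q`. -/
def ehrhartExponents {q : ℕ} (P : Set (Fin q → ℝ)) : Set ((Fin q → ℝ) × ℕ) :=
  {e | e.1 ∈ latticePoints P e.2}

/-- The pairs `(w(a), n)` with `a ∈ nP ∩ ℤ^s`. -/
def weightedExponents {s p : ℕ} (w : (Fin s → ℝ) →ₗ[ℝ] (Fin p → ℝ)) (P : Set (Fin s → ℝ)) :
    Set ((Fin p → ℝ) × ℕ) :=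
  {e | e.1 ∈ w '' latticePoints P e.2}

/-- The Ehrhart ring `A(P) = K[{t^a z^n : a ∈ nP ∩ ℤ^q}]`. -/
noncomputable def ehrhartRing (K : Type*) [Field K] {q : ℕ} (P : Set (Fin q → ℝ)) :
    Subalgebra K (PolyRing K q) :=
  monomialAlgebra K (ehrhartExponents P)

/-- The weighted Ehrhart ring `A^w(P) = K[{y^{w(a)} z^n : a ∈ nP ∩ ℤ^s}]`. -/
noncomputable def weightedEhrhartRing (K : Type*) [Field K] {s p : ℕ}
    (w : (Fin s → ℝ) →ₗ[ℝ] (Fin p → ℝ)) (P : Set (Fin s → ℝ)) : Subalgebra K (PolyRing K p) :=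
  monomialAlgebra K (weightedExponents w P)

/-- `A^w(P)_n`, the `K`-span of the monomials `y^{w(a)} z^n` with `a ∈ nP ∩ ℤ^s`. -/
noncomputable def weightedEhrhartPiece (K : Type*) [Field K] {s p : ℕ}
    (w : (Fin s → ℝ) →ₗ[ℝ] (Fin p → ℝ)) (P : Set (Fin s → ℝ)) (n : ℕ) :
    Submodule K (weightedEhrhartRing K w P) :=
  monomialPiece K (weightedExponents w P) n

/-- The Hilbert function `n ↦ dim_K A^w(P)_n`. -/
noncomputable def hilbertFun (K : Type*) [Field K] {s p : ℕ}
    (w : (Fin s → ℝ) →ₗ[ℝ] (Fin p → ℝ)) (P : Set (Fin s → ℝ)) (n : ℕ) : ℕ :=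
  Module.finrank K (weightedEhrhartPiece K w P n)

/-- The subalgebra `K[{y^{w(v_i)} z}]`. -/
noncomputable def vertexAlgebra (K : Type*) [Field K] {s p m : ℕ}
    (w : (Fin s → ℝ) →ₗ[ℝ] (Fin p → ℝ)) (v : Fin m → Fin s → ℕ) : Subalgebra K (PolyRing K p) :=
  monomialAlgebra K (Set.range fun i => (w (natVec (v i)), 1))

/-- The normalization of a subalgebra `A` of a domain `R`: the integral closure of `A` in its
field of fractions, where the latter is taken inside the field of fractions of `R`. -/
noncomputable def normalization {K R : Type*} [Field K] [CommRing R] [IsDomain R] [Algebra K R]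
    (A : Subalgebra K R) : Subalgebra K (FractionRing R) :=
  (integralClosure A (FractionRing R)).restrictScalars K ⊓
    (IntermediateField.adjoin K (algebraMap R (FractionRing R) '' (A : Set R))).toSubalgebra

/-- A subalgebra of `R`, viewed inside the field of fractions of `R`. -/
noncomputable def inFractions {K R : Type*} [Field K] [CommRing R] [IsDomain R] [Algebra K R]
    (A : Subalgebra K R) : Subalgebra K (FractionRing R) :=
  A.map (IsScalarTower.toAlgHom K R (FractionRing R))

/-- The gcd of all non-zero `k × k` minors of an integer matrix of rank `k`. Rows and columns of
a minor are listed in every order, which changes minors only by a sign. -/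
noncomputable def maximalMinorGcd {ι κ : Type*} [Fintype ι] [DecidableEq ι] [Fintype κ]
    [DecidableEq κ] (B : Matrix ι κ ℤ) : ℤ :=
  ((Finset.univ : Finset ((Fin (B.map (Int.cast : ℤ → ℚ)).rank ↪ ι) ×
      (Fin (B.map (Int.cast : ℤ → ℚ)).rank ↪ κ))).filter
    fun rc => (B.submatrix rc.1 rc.2).det ≠ 0).gcd fun rc => (B.submatrix rc.1 rc.2).det

end WeightedEhrhart

/-! ### Counting points of lower sets in `ℕ^m` -/

/-! All the rings are monoid algebras, so the theorem is about monoids. Put W_i = (w(v_i), 1) and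
let g be the additive map (x, n) ↦ (w(x), n). The exponents of L form the monoid N generated by the
W_i, those of A^w(P) form the image A under g of the lattice points of the cone over P × {1}, and
those of A(w(P)) form the monoid C of lattice points of the cone over the W_i. Thus N ⊆ A ⊆ C.

Finiteness is Gordan's lemma (`exists_coneBox_add`): splitting off integer parts of coefficients
writes a lattice point of a cone as one of finitely many box points plus a natural combination of
the generators. Applying g, A is a finite union of translates of N, which gives (c) and (d).

H(n) counts the points of A at height n. A point may have many presentations a_j + ∑ k_i W_i, but
the lexicographically least ones form, for each j, a lower set of ℕ^m, and the counting series of a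
lower set is a polynomial over (1 - x)^m (`exists_polynomial_sumCount`). The true order of the pole
is read off from growth: if k is the rank of B, a nonzero k × k minor bounds H(n) below by a
positive multiple of n^(k-1) and above by a multiple of (n+1)^(k-1). The columns of this minor also
give a transcendence basis of A^w(P), so k is the Krull dimension.

For (e), an element integral over K[A] is a polynomial, and a comparison of leading forms shows that
a linear functional nonpositive on A is nonpositive on its exponents; separating points from the
cone gives the inclusion in K[C]. As K[C] is integral over K[N], equality throughout means that
every element of C is a difference of elements of N. This says that the column lattice of B is
saturated, which Cramer's rule in one direction and reduction modulo primes in the other identify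
with the gcd of the minors being 1. -/

/-- In a strictly decreasing chain, choose a point lost at each stage. The well-quasi-order puts
some chosen point below a later one, which still lies in all the sets up to its own; by lowerness
the earlier point was never lost. -/
theorem wellFounded_ssubset_of_isLowerSet {α : Type*} [Preorder α] [WellQuasiOrderedLE α] :
    WellFoundedLT (LowerSet α) := by
  rw [WellFoundedLT, isWellFounded_iff, RelEmbedding.wellFounded_iff_isEmpty]
  refine ⟨fun f => ?_⟩
  have h : ∀ i j, i < j → f j < f i := fun i j hij => f.map_rel_iff.2 hij
  have h1 : ∀ i, ∃ a, a ∈ f i ∧ a ∉ f (i + 1) := fun i => by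
    obtain ⟨a, ha, hb⟩ := Set.exists_of_ssubset (h i (i + 1) (Nat.lt_succ_self i))
    exact ⟨a, ha, hb⟩
  choose a ha hb using h1
  obtain ⟨i, j, hij, hle⟩ := wellQuasiOrdered_le (α := α) a
  refine hb i ?_
  have : f j ≤ f (i + 1) := by
    rcases (Nat.succ_le_of_lt hij).eq_or_lt with h' | h'
    · exact le_of_eq (by rw [← h'])
    · exact (h _ _ h').le
  exact (f (i + 1)).lower hle (this (ha j))

/-- The number of points of coordinate sum `n` in a subset of `ℕ^m`. -/
noncomputable def sumCount {m : ℕ} (D : Set (Fin m → ℕ)) (n : ℕ) : ℕ :=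
  {k | k ∈ D ∧ ∑ i, k i = n}.ncard

theorem finite_setOf_sum_eq {m : ℕ} (D : Set (Fin m → ℕ)) (n : ℕ) :
    {k | k ∈ D ∧ ∑ i, k i = n}.Finite := by
  refine (Set.finite_Iic (fun _ : Fin m => n)).subset ?_
  rintro k ⟨-, hk⟩ i
  rw [← hk]
  exact Finset.single_le_sum (fun j _ => Nat.zero_le (k j)) (Finset.mem_univ i)

theorem sumCount_zero_eq {m : ℕ} (D : Set (Fin (m + 1) → ℕ)) :
    sumCount D 0 = sumCount {k : Fin m → ℕ | Fin.cons 0 k ∈ D} 0 := by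
  rw [sumCount, sumCount, ← Set.ncard_image_of_injective {k : Fin m → ℕ | _ ∧ _}
    (Fin.cons_right_injective (α := fun _ => ℕ) 0)]
  congr 1
  ext k
  simp only [Set.mem_ofPred_eq, Set.mem_image]
  constructor
  · rintro ⟨hk, hs⟩
    refine ⟨Fin.tail k, ?_⟩
    have h0 : k 0 = 0 := by rw [Fin.sum_univ_succ] at hs; omega
    have : Fin.cons 0 (Fin.tail k) = k := by rw [← h0]; exact Fin.cons_self_tail k
    rw [this]
    refine ⟨⟨hk, ?_⟩, rfl⟩
    rw [Fin.sum_univ_succ] at hs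
    simp only [Fin.tail]; omega
  · rintro ⟨k', ⟨h1, h2⟩, rfl⟩
    exact ⟨h1, by simpa [Fin.sum_univ_succ] using h2⟩

theorem sumCount_succ_eq {m : ℕ} (D : Set (Fin (m + 1) → ℕ)) (n : ℕ) :
    sumCount D (n + 1) = sumCount {k : Fin m → ℕ | Fin.cons 0 k ∈ D} (n + 1) +
      sumCount {k : Fin (m + 1) → ℕ | k + Pi.single 0 1 ∈ D} n := by
  have e0 := Set.ncard_image_of_injective
    {k : Fin m → ℕ | k ∈ {k : Fin m → ℕ | Fin.cons 0 k ∈ D} ∧ ∑ i, k i = n + 1}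
    (Fin.cons_right_injective (α := fun _ => ℕ) 0)
  have e1 := Set.ncard_image_of_injective
    {k : Fin (m + 1) → ℕ | k ∈ {k | k + Pi.single 0 1 ∈ D} ∧ ∑ i, k i = n}
    (add_left_injective (Pi.single 0 1))
  rw [sumCount, sumCount, sumCount, ← e0, ← e1, ← Set.ncard_union_eq ?_
    ((finite_setOf_sum_eq _ _).image _) ((finite_setOf_sum_eq _ _).image _)]
  · congr 1
    ext k
    simp only [Set.mem_ofPred_eq, Set.mem_union, Set.mem_image]
    constructor
    · rintro ⟨hk, hs⟩
      rw [Fin.sum_univ_succ] at hs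
      rcases Nat.eq_zero_or_pos (k 0) with h0 | h0
      · left
        refine ⟨Fin.tail k, ?_⟩
        have : Fin.cons 0 (Fin.tail k) = k := by rw [← h0]; exact Fin.cons_self_tail k
        rw [this]
        refine ⟨⟨hk, ?_⟩, rfl⟩
        simp only [Fin.tail]; omega
      · right
        have h1 : k - Pi.single 0 1 + Pi.single 0 1 = k := by
          ext i
          refine Fin.cases ?_ (fun j => ?_) i
          · simp; omega
          · simp
        refine ⟨k - Pi.single 0 1, ⟨by rwa [h1], ?_⟩, h1⟩
        rw [Fin.sum_univ_succ]
        simp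
        omega
    · rintro (⟨k', ⟨h1, h2⟩, rfl⟩ | ⟨k', ⟨h1, h2⟩, rfl⟩)
      · exact ⟨h1, by simpa [Fin.sum_univ_succ] using h2⟩
      · refine ⟨h1, ?_⟩
        simp [Finset.sum_add_distrib, h2]
  · rw [Set.disjoint_left]
    rintro k ⟨k', -, rfl⟩ ⟨k'', -, h⟩
    simpa using congrFun h 0

/-- Splitting by whether the first coordinate vanishes gives F_D = F_{D0} + x F_{D1}, with D0 a
slice in one dimension less and D1 ⊆ D the shift of D. If D1 = D this reads (1 - x) F_D = F_{D0};
otherwise D1 is strictly smaller and the descending chain condition applies. -/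
theorem exists_polynomial_sumCount (m : ℕ) : ∀ D : LowerSet (Fin m → ℕ), ∃ h : Polynomial ℤ,
    PowerSeries.mk (fun n => (sumCount (D : Set (Fin m → ℕ)) n : ℤ)) * (1 - PowerSeries.X) ^ m =
      (h : PowerSeries ℤ) := by
  induction m with
  | zero =>
    intro D
    refine ⟨Polynomial.C (sumCount (D : Set (Fin 0 → ℕ)) 0 : ℤ), ?_⟩
    ext n
    rw [pow_zero, mul_one, PowerSeries.coeff_mk, Polynomial.coeff_coe, Polynomial.coeff_C]
    split_ifs with h
    · rw [h]
    · have : {k | k ∈ (D : Set (Fin 0 → ℕ)) ∧ ∑ i, k i = n} = ∅ := by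
        ext k; simp [Ne.symm h]
      rw [sumCount, this, Set.ncard_empty, Nat.cast_zero]
  | succ m ih =>
    have wf : WellFoundedLT (LowerSet (Fin (m + 1) → ℕ)) := wellFounded_ssubset_of_isLowerSet
    intro D
    induction D using wf.induction with
    | ind D IH =>
    let D0 : LowerSet (Fin m → ℕ) := ⟨{k | Fin.cons 0 k ∈ D}, fun a b hab ha =>
      D.lower (Fin.cons_le_cons.2 ⟨le_rfl, hab⟩) ha⟩
    let D1 : LowerSet (Fin (m + 1) → ℕ) := ⟨{k | k + Pi.single 0 1 ∈ D}, fun a b hab ha =>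
      D.lower (by simpa using hab) ha⟩
    have hD1 : D1 ≤ D := fun k hk => D.lower (by simp) hk
    have key : PowerSeries.mk (fun n => (sumCount (D : Set (Fin (m + 1) → ℕ)) n : ℤ)) =
        PowerSeries.mk (fun n => (sumCount (D0 : Set (Fin m → ℕ)) n : ℤ)) +
        PowerSeries.X *
          PowerSeries.mk (fun n => (sumCount (D1 : Set (Fin (m + 1) → ℕ)) n : ℤ)) := by
      ext n
      cases n with
      | zero =>
        simp only [PowerSeries.coeff_mk, map_add, PowerSeries.coeff_zero_X_mul, add_zero]
        exact_mod_cast sumCount_zero_eq _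
      | succ n =>
        simp only [PowerSeries.coeff_mk, map_add, PowerSeries.coeff_succ_X_mul]
        exact_mod_cast sumCount_succ_eq _ n
    obtain ⟨h0, hh0⟩ := ih D0
    rcases hD1.eq_or_lt with h | h
    · rw [h] at key
      refine ⟨h0, ?_⟩
      rw [← hh0]
      linear_combination (1 - PowerSeries.X) ^ m * key
    · obtain ⟨h1, hh1⟩ := IH D1 h
      refine ⟨h0 * (1 - Polynomial.X) + Polynomial.X * h1, ?_⟩
      push_cast
      rw [← hh0, ← hh1, key]
      ring

/-! ### From a Hilbert series with controlled growth to the Hilbert polynomial -/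

theorem natDegree_eq_of_growth (f : Polynomial ℚ) (d : ℕ) (c C : ℚ) (hc : 0 < c)
    (H : ℕ → ℕ) (h1 : ∀ n : ℕ, c * (n : ℚ) ^ d ≤ H n) (h2 : ∀ n : ℕ, (H n : ℚ) ≤ C * ((n : ℚ) + 1) ^ d)
    (hf : ∀ᶠ n : ℕ in Filter.atTop, (H n : ℚ) = f.eval (n : ℚ)) : f.degree = (d : WithBot ℕ) := by
  have hcast : Filter.Tendsto (fun n : ℕ => (n : ℚ)) Filter.atTop Filter.atTop :=
    tendsto_natCast_atTop_atTop
  rcases lt_trichotomy f.degree (d : WithBot ℕ) with h | h | h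
  · exfalso
    have hlim := (Polynomial.div_tendsto_atTop_zero_of_degree_lt f (Polynomial.X ^ d)
      (by simpa using h)).comp hcast
    have hev := hlim.eventually (gt_mem_nhds hc)
    obtain ⟨n, hn, hn1, hn2⟩ := (hev.and ((Filter.eventually_gt_atTop 0).and hf)).exists
    have hpos : (0 : ℚ) < (n : ℚ) ^ d := by positivity
    simp only [Function.comp, Polynomial.eval_pow, Polynomial.eval_X, ← hn2] at hn
    rw [div_lt_iff₀ hpos] at hn
    exact absurd (h1 n) (not_le.2 hn)
  · exact h
  · exfalso
    have hne : ((Polynomial.X + 1 : Polynomial ℚ) ^ d).degree = (d : WithBot ℕ) := by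
      have := Polynomial.degree_X_add_C (1 : ℚ)
      rw [Polynomial.C_1] at this
      simp [Polynomial.degree_pow, this]
    have hlim := (Polynomial.abs_div_tendsto_atTop_atTop_of_degree_gt f
      ((Polynomial.X + 1) ^ d) (by rw [hne]; exact h)
      (by intro h0; rw [h0, Polynomial.degree_zero] at hne; simp at hne)).comp hcast
    obtain ⟨n, hn, hn2⟩ := ((hlim.eventually (Filter.eventually_gt_atTop C)).and hf).exists
    have hpos : (0 : ℚ) < ((n : ℚ) + 1) ^ d := by positivity
    simp only [Function.comp, Polynomial.eval_pow, Polynomial.eval_add, Polynomial.eval_X,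
      Polynomial.eval_one, ← hn2] at hn
    rw [abs_of_nonneg (by positivity), lt_div_iff₀ hpos] at hn
    exact absurd (h2 n) (not_le.2 hn)

/-- After cancelling all factors 1 - x from the numerator, the remaining order e of the pole
determines the degree e - 1 of the Hilbert polynomial, and the growth of H forces e = d + 1. -/
theorem exists_hilbert_polynomial_of_growth (H : ℕ → ℕ) (m d : ℕ) (h : Polynomial ℤ)
    (hH : PowerSeries.mk (fun n => (H n : ℤ)) * (1 - PowerSeries.X) ^ m = (h : PowerSeries ℤ))
    (c C : ℚ) (hc : 0 < c) (h1 : ∀ n : ℕ, c * (n : ℚ) ^ d ≤ H n)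
    (h2 : ∀ n : ℕ, (H n : ℚ) ≤ C * ((n : ℚ) + 1) ^ d) :
    (∃ f : Polynomial ℚ, f.degree = (d : WithBot ℕ) ∧
      ∀ᶠ n : ℕ in Filter.atTop, (H n : ℚ) = f.eval (n : ℚ)) ∧
    (∃ h : Polynomial ℤ, h.eval 1 ≠ 0 ∧
      PowerSeries.mk (fun n => (H n : ℤ)) * (1 - PowerSeries.X) ^ (d + 1) =
        (h : PowerSeries ℤ)) := by
  -- the Hilbert polynomial of a presentation of the series
  have poly : ∀ (g : Polynomial ℤ) (j : ℕ),
      PowerSeries.mk (fun n => (H n : ℤ)) * (1 - PowerSeries.X) ^ j = (g : PowerSeries ℤ) →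
      ∀ᶠ n : ℕ in Filter.atTop, (H n : ℚ) =
        (Polynomial.hilbertPoly (g.map (Int.castRingHom ℚ)) j).eval (n : ℚ) := by
    intro g j hg
    filter_upwards [Filter.eventually_gt_atTop (g.map (Int.castRingHom ℚ)).natDegree] with n hn
    rw [← Polynomial.coeff_mul_invOneSubPow_eq_hilbertPoly_eval j hn]
    have h3 := congrArg (PowerSeries.map (Int.castRingHom ℚ)) hg
    rw [map_mul, map_pow, map_sub, map_one, PowerSeries.map_X, ← Polynomial.polynomial_map_coe] at h3
    rw [← h3, mul_assoc, ← PowerSeries.invOneSubPow_inv_eq_one_sub_pow]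
    simp
  have one_sub_X_ne : ∀ j : ℕ, (1 - PowerSeries.X : PowerSeries ℤ) ^ j ≠ 0 := fun j => by
    refine pow_ne_zero j fun h0 => ?_
    have := congrArg (PowerSeries.coeff 0) h0
    simp at this
  have hne : h ≠ 0 := by
    rintro rfl
    -- The coefficient of degree 1 is used, since at n = 0 the lower bound is 0 when d > 0.
    have h0 : PowerSeries.mk (fun n => (H n : ℤ)) ≠ 0 := by
      intro h0
      have := congrArg (PowerSeries.coeff 1) h0
      have h3 := h1 1
      simp at this h3
      rw [this] at h3
      norm_num at h3
      linarith
    rw [Polynomial.coe_zero] at hH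
    rcases mul_eq_zero.1 hH with h3 | h3
    · exact h0 h3
    · exact one_sub_X_ne _ h3
  obtain ⟨q, hq1, hq2⟩ := Polynomial.exists_eq_pow_rootMultiplicity_mul_and_not_dvd h hne 1
  set j := h.rootMultiplicity 1
  -- The root multiplicity extracts powers of X - 1; the sign (-1)^j turns them into powers of 1 -
  -- X.
  have hq : (1 - PowerSeries.X : PowerSeries ℤ) ^ j * ((-1) ^ j * q : Polynomial ℤ) = h := by
    rw [hq1]
    have : (Polynomial.X - Polynomial.C 1 : Polynomial ℤ) = (-1) * (1 - Polynomial.X) := by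
      simp
    rw [this, mul_pow]
    push_cast
    ring
  have hev : ((-1) ^ j * q : Polynomial ℤ).eval 1 ≠ 0 := by
    rw [Polynomial.dvd_iff_isRoot] at hq2
    simpa using hq2
  set g : Polynomial ℤ := (-1) ^ j * q
  have hgroot : (g.map (Int.castRingHom ℚ)).rootMultiplicity 1 = 0 := by
    apply Polynomial.rootMultiplicity_eq_zero
    rw [Polynomial.IsRoot, Polynomial.eval_one_map]
    simpa using hev
  have hgne : g.map (Int.castRingHom ℚ) ≠ 0 := by
    rw [Ne, Polynomial.map_eq_zero_iff (RingHom.injective_int _)]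
    intro h0
    rw [h0] at hev
    simp at hev
  rcases le_or_gt m j with hmj | hmj
  · exfalso
    -- Without a pole the series is a polynomial, so H would vanish eventually.
    have h3 : PowerSeries.mk (fun n => (H n : ℤ)) * (1 - PowerSeries.X) ^ 0 =
        (((1 - Polynomial.X) ^ (j - m) * g : Polynomial ℤ) : PowerSeries ℤ) := by
      apply mul_right_cancel₀ (one_sub_X_ne m)
      rw [pow_zero, mul_one, hH, ← hq, ← Nat.sub_add_cancel hmj, Nat.add_sub_cancel]
      push_cast
      ring
    obtain ⟨n, hn, hn1⟩ := ((poly _ 0 h3).and (Filter.eventually_gt_atTop 0)).exists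
    rw [Polynomial.hilbertPoly_zero_right, Polynomial.eval_zero] at hn
    have h4 := h1 n
    have : 0 < c * (n : ℚ) ^ d := by positivity
    linarith
  · have h3 : PowerSeries.mk (fun n => (H n : ℤ)) * (1 - PowerSeries.X) ^ (m - j) =
        (g : PowerSeries ℤ) := by
      apply mul_right_cancel₀ (one_sub_X_ne j)
      rw [mul_assoc, ← pow_add, Nat.sub_add_cancel hmj.le, hH, ← hq, mul_comm]
    have h4 := poly _ _ h3
    have h5 := natDegree_eq_of_growth _ d c C hc H h1 h2 h4
    refine ⟨⟨_, h5, h4⟩, g, hev, ?_⟩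
    have h6 := Polynomial.natDegree_hilbertPoly_of_ne_zero_of_rootMultiplicity_lt
      (d := m - j) hgne (by rw [hgroot]; omega)
    rw [Polynomial.natDegree_eq_of_degree_eq_some h5, hgroot] at h6
    have h7 : d + 1 = m - j := by omega
    rw [h7, h3]

/-! ### Standard representatives in a finitely generated module over a graded monoid -/

section Standard

variable {M : Type*} [AddCommMonoid M] {r m : ℕ}

/-- The points `k` of `ℕ^m` for which `(j, k)` is the lexicographically least presentation
of `g j + ∑ i, k i • W i`. -/
def standardSet (g : Fin r → M) (W : Fin m → M) (j : Fin r) : LowerSet (Fin m → ℕ) where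
  carrier := {k | ∀ j' k', g j' + ∑ i, k' i • W i = g j + ∑ i, k i • W i →
    toLex (j, toLex k) ≤ toLex (j', toLex k')}
  lower' := by
    intro a b hab ha j' k' h
    -- Adding l to a competing presentation for b gives one for b + l; minimality is applied there,
    -- and l is then cancelled because the lexicographic order is translation invariant. No
    -- cancellation in M is needed.
    obtain ⟨l, rfl⟩ := exists_add_of_le hab
    have h1 := ha j' (k' + l) (by
      simp only [Pi.add_apply, add_smul, Finset.sum_add_distrib, ← add_assoc, h])
    rw [Prod.Lex.toLex_le_toLex] at h1 ⊢
    refine h1.imp_right fun h2 => ⟨h2.1, ?_⟩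
    exact le_of_add_le_add_right (show toLex b + toLex l ≤ toLex k' + toLex l from h2.2)

theorem exists_mem_standardSet (g : Fin r → M) (W : Fin m → M) (j : Fin r) (k : Fin m → ℕ) :
    ∃ j' k', k' ∈ standardSet g W j' ∧ g j' + ∑ i, k' i • W i = g j + ∑ i, k i • W i := by
  have wf : WellFounded (fun a b : Fin r ×ₗ Lex (Fin m → ℕ) => a < b) := wellFounded_lt
  obtain ⟨x, hx, hmin⟩ := wf.has_min
    {x : Fin r ×ₗ Lex (Fin m → ℕ) | g (ofLex x).1 + ∑ i, ofLex (ofLex x).2 i • W i =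
      g j + ∑ i, k i • W i} ⟨toLex (j, toLex k), rfl⟩
  refine ⟨(ofLex x).1, ofLex (ofLex x).2, fun j' k' h => ?_, hx⟩
  exact not_lt.1 (hmin (toLex (j', toLex k')) (h.trans hx))

/-- Every element has exactly one lexicographically least presentation, so the series is the sum
over j of x^(deg g_j) times the series of a lower set. -/
theorem exists_polynomial_count (deg : M →+ ℕ) (g : Fin r → M) (W : Fin m → M)
    (hW : ∀ i, deg (W i) = 1) :
    ∃ h : Polynomial ℤ, PowerSeries.mk (fun n =>
        ({x | (∃ j, ∃ k : Fin m → ℕ, x = g j + ∑ i, k i • W i) ∧ deg x = n}.ncard : ℤ)) *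
      (1 - PowerSeries.X) ^ m = (h : PowerSeries ℤ) := by
  classical
  choose h hh using fun j => exists_polynomial_sumCount m (standardSet g W j)
  refine ⟨∑ j, Polynomial.X ^ deg (g j) * h j, ?_⟩
  have hdeg : ∀ j (k : Fin m → ℕ), deg (g j + ∑ i, k i • W i) = deg (g j) + ∑ i, k i := by
    intro j k; simp [hW]
  have key : PowerSeries.mk (fun n =>
        ({x | (∃ j, ∃ k : Fin m → ℕ, x = g j + ∑ i, k i • W i) ∧ deg x = n}.ncard : ℤ)) =
      ∑ j, PowerSeries.X ^ deg (g j) * PowerSeries.mk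
        (fun n => (sumCount (standardSet g W j : Set (Fin m → ℕ)) n : ℤ)) := by
    ext n
    rw [map_sum, PowerSeries.coeff_mk]
    simp only [PowerSeries.coeff_X_pow_mul', PowerSeries.coeff_mk]
    let T : Fin r → Set (Fin m → ℕ) := fun j =>
      {k | k ∈ standardSet g W j ∧ deg (g j) + ∑ i, k i = n}
    have hT : ∀ j, (T j).Finite := fun j => by
      refine (Set.finite_Iic (fun _ : Fin m => n)).subset ?_
      rintro k ⟨-, hk⟩ i
      have := Finset.single_le_sum (fun j _ => Nat.zero_le (k j)) (Finset.mem_univ i)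
      simp only
      omega
    have himg : {x | (∃ j, ∃ k : Fin m → ℕ, x = g j + ∑ i, k i • W i) ∧ deg x = n} =
        ((Finset.univ.sigma fun j => (hT j).toFinset).image
          fun y : (_ : Fin r) × (Fin m → ℕ) => g y.1 + ∑ i, y.2 i • W i : Finset M) := by
      ext x
      simp only [Set.mem_ofPred_eq, Finset.coe_image, Set.mem_image, Finset.mem_coe,
        Finset.mem_sigma, Finset.mem_univ, true_and, Set.Finite.mem_toFinset]
      constructor
      · rintro ⟨⟨j, k, rfl⟩, hx⟩
        obtain ⟨j', k', h1, h2⟩ := exists_mem_standardSet g W j k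
        exact ⟨⟨j', k'⟩, ⟨h1, by rw [← hdeg, h2, hx]⟩, h2⟩
      · rintro ⟨⟨j, k⟩, ⟨h1, h2⟩, rfl⟩
        exact ⟨⟨j, k, rfl⟩, by rw [hdeg, h2]⟩
    rw [himg, Set.ncard_coe_finset, Finset.card_image_of_injOn, Finset.card_sigma]
    · push_cast
      refine Finset.sum_congr rfl fun j _ => ?_
      rw [← Set.ncard_eq_toFinset_card _ (hT j)]
      split_ifs with hle
      · congr 2
        ext k
        simp only [T, Set.mem_ofPred_eq, SetLike.mem_coe]
        refine and_congr_right fun _ => ?_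
        omega
      · have : T j = ∅ := by
          ext k
          simp only [T, Set.mem_ofPred_eq, Set.mem_empty_iff_false, iff_false]
          rintro ⟨-, h2⟩
          omega
        rw [this, Set.ncard_empty, Nat.cast_zero]
    · rintro ⟨j, k⟩ h1 ⟨j', k'⟩ h2 h3
      simp only [Finset.coe_sigma, Set.mem_sigma_iff, Finset.mem_coe, Finset.mem_univ, true_and,
        Set.Finite.mem_toFinset] at h1 h2
      have e := le_antisymm (h1.1 j' k' h3.symm) (h2.1 j k h3)
      have e' := toLex.injective e
      rw [Prod.mk.injEq] at e'
      obtain ⟨rfl, e2⟩ := e'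
      rw [toLex.injective e2]
  rw [key, Finset.sum_mul]
  simp only [mul_assoc, hh]
  rw [← Polynomial.coeToPowerSeries.ringHom_apply, map_sum]
  simp

end Standard

/-! ### Minors, rank, and saturation of the column lattice -/

section Minors

variable {ι κ : Type*} [Fintype ι] [Fintype κ]

theorem exists_linearIndependent_fin {F V : Type*} [Field F] [AddCommGroup V] [Module F V]
    {s : Set V} {k : ℕ} (hk : k ≤ Module.finrank F (Submodule.span F s)) [Module.Finite F V] :
    ∃ f : Fin k → V, (∀ i, f i ∈ s) ∧ LinearIndependent F f := by
  obtain ⟨f, hf, -, hli⟩ := Submodule.exists_fun_fin_finrank_span_eq F s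
  exact ⟨f ∘ Fin.castLE hk, fun i => hf _, hli.comp _ (Fin.castLE_injective hk)⟩

/-- Choose k independent columns, then k independent rows of the resulting submatrix. -/
theorem exists_det_submatrix_ne_zero {F : Type*} [Field F] (A : Matrix ι κ F) {k : ℕ}
    (hk : k ≤ A.rank) : ∃ (r : Fin k ↪ ι) (c : Fin k ↪ κ), (A.submatrix r c).det ≠ 0 := by
  rw [Matrix.rank_eq_finrank_span_cols] at hk
  obtain ⟨f, hf, hli'⟩ := exists_linearIndependent_fin hk
  choose c hc using hf
  have hcols : LinearIndependent F (A.submatrix id c).col := by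
    have : (A.submatrix id c).col = f := funext fun j => hc j
    rwa [this]
  have hrank : (A.submatrix id c).rank = k := by
    rw [← Matrix.rank_transpose]
    simpa using LinearIndependent.rank_matrix (M := (A.submatrix id c).transpose) hcols
  rw [Matrix.rank_eq_finrank_span_row] at hrank
  obtain ⟨g, hg, hli2⟩ := exists_linearIndependent_fin hrank.ge
  choose r hr using hg
  have hrows : LinearIndependent F (A.submatrix r c).row := by
    have : (A.submatrix r c).row = g := funext fun j => hr j
    rwa [this]
  have hdet : (A.submatrix r c).det ≠ 0 :=
    ((Matrix.isUnit_iff_isUnit_det _).1 (Matrix.linearIndependent_rows_iff_isUnit.1 hrows)).ne_zero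
  refine ⟨⟨r, fun a b hab => hrows.injective ?_⟩, ⟨c, fun a b hab => hli'.injective ?_⟩, hdet⟩
  · ext j; simp [Matrix.row, hab]
  · rw [← hc, ← hc, hab]

omit [Fintype ι] in
theorem le_rank_of_det_submatrix_ne_zero {F : Type*} [Field F] (A : Matrix ι κ F) {k : ℕ}
    (r : Fin k → ι) (c : Fin k → κ) (h : (A.submatrix r c).det ≠ 0) : k ≤ A.rank := by
  have h1 := A.rank_submatrix_le r c
  rwa [Matrix.rank_of_det_ne_zero h, Fintype.card_fin] at h1

omit [Fintype ι] [Fintype κ] in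
theorem det_submatrix_map_intCast {F : Type*} [Field F] (B : Matrix ι κ ℤ) {k : ℕ}
    (r : Fin k → ι) (c : Fin k → κ) :
    ((B.map (Int.cast : ℤ → F)).submatrix r c).det = ((B.submatrix r c).det : F) := by
  rw [Int.cast_det, Matrix.submatrix_map]

/-- The rank over `ℚ` of an integer matrix. -/
noncomputable abbrev intRank (B : Matrix ι κ ℤ) : ℕ := (B.map (Int.cast : ℤ → ℚ)).rank

theorem exists_minor_ne_zero (B : Matrix ι κ ℤ) :
    ∃ (r : Fin (intRank B) ↪ ι) (c : Fin (intRank B) ↪ κ), (B.submatrix r c).det ≠ 0 := by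
  obtain ⟨r, c, h⟩ := exists_det_submatrix_ne_zero (B.map (Int.cast : ℤ → ℚ)) le_rfl
  refine ⟨r, c, ?_⟩
  rwa [det_submatrix_map_intCast, Int.cast_ne_zero] at h

/-- Ranks are detected by minors, and the minors are the same integers over both fields. -/
theorem rank_map_intCast_real_le (B : Matrix ι κ ℤ) :
    (B.map (Int.cast : ℤ → ℝ)).rank ≤ intRank B := by
  obtain ⟨r, c, h⟩ := exists_det_submatrix_ne_zero (B.map (Int.cast : ℤ → ℝ)) le_rfl
  rw [det_submatrix_map_intCast, Int.cast_ne_zero] at h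
  refine le_rank_of_det_submatrix_ne_zero _ r c ?_
  rwa [det_submatrix_map_intCast, Int.cast_ne_zero]

theorem exists_eq_sum_of_mem_span_col (B : Matrix ι κ ℤ) (r : Fin (intRank B) → ι)
    (c : Fin (intRank B) → κ) (h : (B.submatrix r c).det ≠ 0) (x : ι → ℝ)
    (hx : x ∈ Submodule.span ℝ (Set.range (B.map (Int.cast : ℤ → ℝ)).col)) :
    ∃ q : Fin (intRank B) → ℝ, ∀ i, x i = ∑ j, (B i (c j) : ℝ) * q j := by
  set A := B.map (Int.cast : ℤ → ℝ)
  have hdet : (A.submatrix r c).det ≠ 0 := by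
    rwa [det_submatrix_map_intCast, Int.cast_ne_zero]
  have hli : LinearIndependent ℝ (fun j => A.col (c j)) := by
    have h1 := Matrix.linearIndependent_cols_of_det_ne_zero hdet
    exact LinearIndependent.of_comp (LinearMap.funLeft ℝ ℝ r) h1
  have hle : Submodule.span ℝ (Set.range fun j => A.col (c j)) ≤
      Submodule.span ℝ (Set.range A.col) :=
    Submodule.span_mono (by rintro _ ⟨j, rfl⟩; exact ⟨c j, rfl⟩)
  have heq := Submodule.eq_of_le_of_finrank_le hle (by
    rw [← Matrix.rank_eq_finrank_span_cols, finrank_span_eq_card hli, Fintype.card_fin]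
    exact rank_map_intCast_real_le B)
  rw [← heq, Submodule.mem_span_range_iff_exists_fun] at hx
  obtain ⟨q, rfl⟩ := hx
  refine ⟨q, fun i => ?_⟩
  simp only [Finset.sum_apply, Pi.smul_apply, smul_eq_mul]
  exact Finset.sum_congr rfl fun j _ => mul_comm _ _

/-- Cramer's rule for integral vectors in the real column span of an integer matrix. -/
theorem minor_smul_eq_sum (B : Matrix ι κ ℤ) (r : Fin (intRank B) → ι)
    (c : Fin (intRank B) → κ) (h : (B.submatrix r c).det ≠ 0) (x : ι → ℤ)
    (hx : (fun i => (x i : ℝ)) ∈ Submodule.span ℝ (Set.range (B.map (Int.cast : ℤ → ℝ)).col))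
    (i : ι) : (B.submatrix r c).det * x i =
      ∑ j, B i (c j) * ((B.submatrix r c).adjugate.mulVec (x ∘ r)) j := by
  obtain ⟨q, hq⟩ := exists_eq_sum_of_mem_span_col B r c h _ hx
  set M := B.submatrix r c
  set MR := M.map (Int.cast : ℤ → ℝ)
  have h1 : (fun i => ((x ∘ r) i : ℝ)) = MR.mulVec q := by
    ext i; simp only [Function.comp, hq (r i), Matrix.mulVec, dotProduct]; rfl
  have h2 : ∀ j, ((M.adjugate.mulVec (x ∘ r)) j : ℝ) = (M.det : ℝ) * q j := by
    intro j
    have h3 : (M.adjugate.map (Int.cast : ℤ → ℝ)) = MR.adjugate :=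
      (Int.castRingHom ℝ).map_adjugate M
    have h4 : ((M.adjugate.mulVec (x ∘ r)) j : ℝ) =
        (M.adjugate.map (Int.cast : ℤ → ℝ)).mulVec (fun i => ((x ∘ r) i : ℝ)) j := by
      simp [Matrix.mulVec, dotProduct]
    rw [h4, h3, h1, Matrix.mulVec_mulVec, Matrix.adjugate_mul, Matrix.smul_mulVec,
      Matrix.one_mulVec, Int.cast_det]
    rfl
  have : (((B.submatrix r c).det * x i : ℤ) : ℝ) =
      ((∑ j, B i (c j) * (M.adjugate.mulVec (x ∘ r)) j : ℤ) : ℝ) := by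
    push_cast
    simp only [h2, hq i, Finset.mul_sum]
    refine Finset.sum_congr rfl fun j _ => ?_
    push_cast
    ring
  exact_mod_cast this

variable [DecidableEq ι] [DecidableEq κ]

-- The integers d with d x in the column lattice form an ideal. By Cramer's rule it contains every
-- nonzero maximal minor, so its generator divides their gcd.
open WeightedEhrhart in
theorem mem_span_col_of_maximalMinorGcd_eq_one (B : Matrix ι κ ℤ) (hB : maximalMinorGcd B = 1)
    (x : ι → ℤ)
    (hx : (fun i => (x i : ℝ)) ∈ Submodule.span ℝ (Set.range (B.map (Int.cast : ℤ → ℝ)).col)) :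
    x ∈ Submodule.span ℤ (Set.range B.col) := by
  set I : Ideal ℤ := (Submodule.span ℤ (Set.range B.col)).comap (LinearMap.toSpanSingleton ℤ _ x)
  have hmem : ∀ d, d ∈ I ↔ d • x ∈ Submodule.span ℤ (Set.range B.col) := fun d => Iff.rfl
  obtain ⟨g, hg⟩ := (IsPrincipalIdealRing.principal I).principal
  have hdvd : g ∣ maximalMinorGcd B := by
    refine Finset.dvd_gcd fun rc hrc => ?_
    have hne := (Finset.mem_filter.1 hrc).2
    have : (B.submatrix rc.1 rc.2).det ∈ I := by
      rw [hmem]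
      have : (B.submatrix rc.1 rc.2).det • x =
          ∑ j, ((B.submatrix rc.1 rc.2).adjugate.mulVec (x ∘ rc.1)) j • B.col (rc.2 j) := by
        ext i
        simp only [Pi.smul_apply, smul_eq_mul, Finset.sum_apply]
        rw [minor_smul_eq_sum B rc.1 rc.2 hne x hx i]
        exact Finset.sum_congr rfl fun j _ => mul_comm _ _
      rw [this]
      exact Submodule.sum_mem _ fun j _ => Submodule.smul_mem _ _ (Submodule.subset_span ⟨_, rfl⟩)
    rw [hg] at this
    exact Ideal.mem_span_singleton.1 this
  rw [hB] at hdvd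
  have : (1 : ℤ) ∈ I := by rw [hg]; exact Ideal.mem_span_singleton.2 hdvd
  simpa [hmem] using this

-- A saturated column lattice is a direct summand, so B is split: R' B S' = 1. This identity
-- survives reduction modulo any prime q, so the rank does not drop there and some maximal minor is
-- prime to q.
open WeightedEhrhart in
theorem maximalMinorGcd_eq_one_of_saturated (B : Matrix ι κ ℤ)
    (h : ∀ (d : ℤ) (x : ι → ℤ), d ≠ 0 → d • x ∈ Submodule.span ℤ (Set.range B.col) →
      x ∈ Submodule.span ℤ (Set.range B.col)) : maximalMinorGcd B = 1 := by
  set N := Submodule.span ℤ (Set.range B.col) with hN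
  have hrange : LinearMap.range B.mulVecLin = N := Matrix.range_mulVecLin B
  -- the column lattice is a direct summand
  have htf : Module.IsTorsionFree ℤ ((ι → ℤ) ⧸ N) := by
    refine ⟨fun r hr => ?_⟩
    rw [isSMulRegular_iff_right_eq_zero_of_smul]
    intro y hy
    obtain ⟨x, rfl⟩ := N.mkQ_surjective y
    rw [← map_smul, Submodule.mkQ_apply, Submodule.Quotient.mk_eq_zero] at hy
    rw [Submodule.mkQ_apply, Submodule.Quotient.mk_eq_zero]
    exact h r x hr.ne_zero hy
  obtain ⟨ρ, hρ⟩ : ∃ ρ : (ι → ℤ) →ₗ[ℤ] N, ∀ y : N, ρ y = y := by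
    have : Module.Free ℤ ((ι → ℤ) ⧸ N) := Module.free_of_finite_type_torsion_free'
    obtain ⟨t, ht⟩ := Module.projective_lifting_property N.mkQ LinearMap.id N.mkQ_surjective
    refine ⟨LinearMap.codRestrict N (LinearMap.id - t ∘ₗ N.mkQ) fun x => ?_, fun y => ?_⟩
    · rw [← Submodule.Quotient.mk_eq_zero, ← Submodule.mkQ_apply]
      have := LinearMap.congr_fun ht (N.mkQ x)
      simp only [LinearMap.comp_apply, LinearMap.id_apply] at this
      rw [LinearMap.sub_apply, map_sub, LinearMap.id_apply, LinearMap.comp_apply, this, sub_self]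
    · ext1
      have : N.mkQ (y : ι → ℤ) = 0 := by simp
      simp [this]
  let b := Module.finBasis ℤ N
  obtain ⟨S, hS⟩ : ∃ S : N →ₗ[ℤ] (κ → ℤ), ∀ y : N, B.mulVecLin (S y) = y := by
    obtain ⟨S, hS⟩ := Module.projective_lifting_property
      (LinearMap.codRestrict N B.mulVecLin fun x => hrange ▸ LinearMap.mem_range_self _ x)
      LinearMap.id (fun y => by
        obtain ⟨x, hx⟩ := (hrange.ge y.2 : (y : ι → ℤ) ∈ LinearMap.range B.mulVecLin)
        exact ⟨x, Subtype.ext hx⟩)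
    exact ⟨S, fun y => congrArg Subtype.val (LinearMap.congr_fun hS y)⟩
  set d := Module.finrank ℤ N
  let R' : Matrix (Fin d) ι ℤ := LinearMap.toMatrix' (b.equivFun.toLinearMap ∘ₗ ρ)
  let S' : Matrix κ (Fin d) ℤ := LinearMap.toMatrix' (S ∘ₗ b.equivFun.symm.toLinearMap)
  have hB : B = LinearMap.toMatrix' B.mulVecLin := by
    rw [← Matrix.toLin'_apply', LinearMap.toMatrix'_toLin']
  have hRBS : R' * B * S' = 1 := by
    rw [hB, ← LinearMap.toMatrix'_comp, ← LinearMap.toMatrix'_comp, ← LinearMap.toMatrix'_id]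
    congr 1
    refine LinearMap.ext fun x => ?_
    simp only [LinearMap.comp_apply, LinearEquiv.coe_coe, hS, hρ, LinearEquiv.apply_symm_apply,
      LinearMap.id_apply]
  -- B factors through ℤ^d, so its rational rank is at most d.
  have hfac : B = (B * S') * (R' * B) := by
    conv_lhs => rw [hB]
    rw [hB, ← LinearMap.toMatrix'_comp, ← LinearMap.toMatrix'_comp, ← LinearMap.toMatrix'_comp]
    congr 1
    refine LinearMap.ext fun x => ?_
    have : ∀ x, (ρ (B.mulVecLin x) : ι → ℤ) = B.mulVecLin x := fun x =>
      congrArg Subtype.val (hρ ⟨B.mulVecLin x, hrange ▸ LinearMap.mem_range_self _ x⟩)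
    simp only [LinearMap.comp_apply, LinearEquiv.coe_coe, LinearEquiv.symm_apply_apply, hS, this]
    rw [← hB]
  have hrank : intRank B ≤ d := by
    have h1 : B.map (Int.cast : ℤ → ℚ) =
        (B * S').map (Int.cast : ℤ → ℚ) * (R' * B).map (Int.cast : ℤ → ℚ) := by
      conv_lhs => rw [hfac]
      exact Matrix.map_mul (f := Int.castRingHom ℚ)
    rw [intRank, h1]
    exact (Matrix.rank_mul_le_left _ _).trans (by
      simpa using Matrix.rank_le_card_width ((B * S').map (Int.cast : ℤ → ℚ)))
  by_contra hne
  -- The gcd is normalized, hence nonnegative; differing from 1, it has a prime divisor, even if it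
  -- is 0.
  have hnn : 0 ≤ maximalMinorGcd B := by
    have : normalize (maximalMinorGcd B) = maximalMinorGcd B := Finset.normalize_gcd
    rw [← this]
    exact Int.nonneg_of_normalize_eq_self (normalize_idem _)
  obtain ⟨q, hq, hdvd⟩ := Nat.exists_prime_and_dvd (n := (maximalMinorGcd B).natAbs) (by omega)
  have : Fact q.Prime := ⟨hq⟩
  have hle : intRank B ≤ (B.map (Int.cast : ℤ → ZMod q)).rank := by
    have h1 : R'.map (Int.cast : ℤ → ZMod q) * B.map (Int.cast : ℤ → ZMod q) *
        S'.map (Int.cast : ℤ → ZMod q) = 1 := by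
      have h2 := congrArg (fun M => M.map (Int.castRingHom (ZMod q))) hRBS
      simp only [Matrix.map_mul] at h2
      rw [Matrix.map_one _ (map_zero _) (map_one _)] at h2
      exact h2
    have h3 : d = (1 : Matrix (Fin d) (Fin d) (ZMod q)).rank := by
      rw [Matrix.rank_one, Fintype.card_fin]
    rw [← h1] at h3
    calc intRank B ≤ d := hrank
      _ = _ := h3
      _ ≤ _ := (Matrix.rank_mul_le_left _ _).trans (Matrix.rank_mul_le_right _ _)
  obtain ⟨r, c, hdet⟩ := exists_det_submatrix_ne_zero _ hle
  rw [det_submatrix_map_intCast] at hdet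
  apply hdet
  rw [ZMod.intCast_zmod_eq_zero_iff_dvd]
  refine (Int.natCast_dvd.2 hdvd).trans (Finset.gcd_dvd (b := (r, c)) ?_)
  refine Finset.mem_filter.2 ⟨Finset.mem_univ _, fun h0 => hdet ?_⟩
  rw [h0, Int.cast_zero]

end Minors

/-! ### Krull dimension and transcendence degree -/

/-- Incomparability bounds the dimension of S above; lying over and going up lift chains from R. -/
theorem ringKrullDim_eq_of_isIntegral (R S : Type*) [CommRing R] [CommRing S] [Algebra R S]
    [Algebra.IsIntegral R S] (hinj : Function.Injective (algebraMap R S)) :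
    ringKrullDim S = ringKrullDim R := by
  apply le_antisymm
  · refine Order.krullDim_le_of_strictMono (PrimeSpectrum.comap (algebraMap R S)) ?_
    intro p q hpq
    exact Ideal.IsIntegral.comap_lt_comap (R := R) (I := p.asIdeal) (J := q.asIdeal) hpq
  · refine iSup_le fun l => ?_
    obtain ⟨Q, hQ, hQl⟩ := Ideal.exists_ideal_over_prime_of_isIntegral
      (S := S) l.head.asIdeal ⊥ (by
        rw [Ideal.comap_bot_of_injective _ hinj]
        exact bot_le)
    have := hQl.1
    have : Q.LiesOver l.head.asIdeal := ⟨hQl.2.symm⟩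
    obtain ⟨l', hl', -⟩ := Ideal.exists_ltSeries_of_hasGoingUp l Q
    rw [← hl']
    exact le_iSup (fun l : LTSeries (PrimeSpectrum S) => (l.length : WithBot ℕ∞)) l'

/-- By Noether normalization A is integral over a polynomial ring, whose variables form a
transcendence basis of A and so number k. -/
theorem ringKrullDim_eq_of_isTranscendenceBasis {K A : Type*} [Field K] [CommRing A] [IsDomain A]
    [Algebra K A] [Algebra.FiniteType K A] {k : ℕ} {x : Fin k → A}
    (hx : IsTranscendenceBasis K x) : ringKrullDim A = (k : WithBot ℕ∞) := by
  obtain ⟨s, g, hg, hint⟩ := exists_integral_inj_algHom_of_fg K A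
  algebraize [g.toRingHom]
  have hinj : Function.Injective (algebraMap (MvPolynomial (Fin s) K) A) := hg
  have : Algebra.IsIntegral (MvPolynomial (Fin s) K) A := ⟨hint⟩
  have : FaithfulSMul (MvPolynomial (Fin s) K) A := (faithfulSMul_iff_algebraMap_injective _ _).2 hinj
  have : IsScalarTower K (MvPolynomial (Fin s) K) A := IsScalarTower.of_algHom g
  have hb := (IsTranscendenceBasis.mvPolynomial (Fin s) K).algebraMap_comp (A := A)
  have hcard := hb.lift_cardinalMk_eq hx
  simp only [Cardinal.mk_fin, Cardinal.lift_natCast, Nat.cast_inj] at hcard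
  rw [ringKrullDim_eq_of_isIntegral _ _ hinj, MvPolynomial.ringKrullDim_of_isNoetherianRing,
    ringKrullDim_eq_zero_of_field, zero_add, Nat.card_eq_fintype_card, Fintype.card_fin, hcard]

/-! ### Monomial subalgebras -/

section Supported

open MvPolynomial

variable (K : Type*) [Field K] {σ : Type*}

/-- The polynomials whose exponents lie in a submonoid. -/
def supportedSubalgebra (S : AddSubmonoid (σ →₀ ℕ)) : Subalgebra K (MvPolynomial σ K) where
  carrier := {f | ∀ e ∈ f.support, e ∈ S}
  mul_mem' := by
    classical
    intro f g hf hg e he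
    obtain ⟨a, ha, b, hb, rfl⟩ := Finset.mem_add.1 (support_mul f g he)
    exact S.add_mem (hf a ha) (hg b hb)
  add_mem' := by
    classical
    intro f g hf hg e he
    exact (Finset.mem_union.1 (support_add he)).elim (hf e) (hg e)
  algebraMap_mem' := by
    classical
    intro c e he
    rw [mem_support_iff, algebraMap_eq, coeff_C] at he
    split_ifs at he with h
    · rw [← h]; exact S.zero_mem
    · exact absurd rfl he

variable {K}

theorem monomial_mem_supportedSubalgebra {S : AddSubmonoid (σ →₀ ℕ)} {e : σ →₀ ℕ} (he : e ∈ S)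
    (c : K) : monomial e c ∈ supportedSubalgebra K S := by
  intro e' he'
  rw [Finset.mem_singleton.1 (support_monomial_subset he')]
  exact he

theorem supportedSubalgebra_mono {S T : AddSubmonoid (σ →₀ ℕ)} (h : S ≤ T) :
    supportedSubalgebra K S ≤ supportedSubalgebra K T := fun _ hf e he => h (hf e he)

theorem adjoin_monomial_eq_supportedSubalgebra (E : Set (σ →₀ ℕ)) :
    Algebra.adjoin K ((fun e => monomial e (1 : K)) '' E) =
      supportedSubalgebra K (AddSubmonoid.closure E) := by
  apply le_antisymm
  · rw [Algebra.adjoin_le_iff]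
    rintro _ ⟨e, he, rfl⟩
    exact monomial_mem_supportedSubalgebra (AddSubmonoid.subset_closure he) 1
  · intro f hf
    rw [f.as_sum]
    refine Subalgebra.sum_mem _ fun e he => ?_
    have key : monomial e (1 : K) ∈ Algebra.adjoin K ((fun e => monomial e (1 : K)) '' E) := by
      refine AddSubmonoid.closure_induction (motive := fun e _ =>
        monomial e (1 : K) ∈ Algebra.adjoin K ((fun e => monomial e (1 : K)) '' E)) ?_ ?_ ?_ (hf e he)
      · exact fun e he => Algebra.subset_adjoin ⟨e, he, rfl⟩
      · exact Subalgebra.one_mem _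
      · intro a b _ _ ha hb
        have := Subalgebra.mul_mem _ ha hb
        rwa [monomial_mul, one_mul] at this
    have := Subalgebra.smul_mem _ key (coeff e f)
    rwa [smul_monomial, smul_eq_mul, mul_one] at this

/-- A ring of polynomials with exponents in `T` is finite over one with exponents in `S`
when `T` is covered by finitely many translates of `S`. -/
theorem inclusion_supportedSubalgebra_finite {S T : AddSubmonoid (σ →₀ ℕ)} (hST : S ≤ T)
    {F : Set (σ →₀ ℕ)} (hF : F.Finite) (hFT : F ⊆ T) (h : ∀ e ∈ T, ∃ a ∈ F, ∃ b ∈ S, e = a + b) :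
    (Subalgebra.inclusion (supportedSubalgebra_mono (K := K) hST)).toRingHom.Finite := by
  classical
  algebraize [(Subalgebra.inclusion (supportedSubalgebra_mono (K := K) hST)).toRingHom]
  have := hF.to_subtype
  let gen : F → supportedSubalgebra K T := fun a =>
    ⟨monomial (a : σ →₀ ℕ) 1, monomial_mem_supportedSubalgebra (hFT a.2) 1⟩
  have htop : Submodule.span (supportedSubalgebra K S) (Set.range gen) = ⊤ := by
    rw [eq_top_iff]
    rintro ⟨f, hf⟩ -
    have hsum : (⟨f, hf⟩ : supportedSubalgebra K T) = ∑ e ∈ f.support.attach,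
        ⟨monomial e.1 (coeff e.1 f), monomial_mem_supportedSubalgebra (hf e.1 e.2) _⟩ := by
      apply Subtype.ext
      rw [AddSubmonoidClass.coe_finsetSum]
      refine f.as_sum.trans ?_
      exact (Finset.sum_attach f.support fun e => monomial e (coeff e f)).symm
    rw [hsum]
    refine Submodule.sum_mem _ fun e _ => ?_
    obtain ⟨a, ha, b, hb, hab⟩ := h e.1 (hf e.1 e.2)
    have : (⟨monomial e.1 (coeff e.1 f), monomial_mem_supportedSubalgebra (hf e.1 e.2) _⟩ :
        supportedSubalgebra K T) =
        (⟨monomial b (coeff e.1 f), monomial_mem_supportedSubalgebra hb _⟩ :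
          supportedSubalgebra K S) • gen ⟨a, ha⟩ := by
      apply Subtype.ext
      change monomial e.1 (coeff e.1 f) = monomial b (coeff e.1 f) * monomial a 1
      rw [monomial_mul, mul_one, hab, add_comm a b]
    rw [this]
    exact Submodule.smul_mem _ _ (Submodule.subset_span ⟨_, rfl⟩)
  have hfin : Module.Finite (supportedSubalgebra K S) (supportedSubalgebra K T) :=
    ⟨(Set.finite_range gen).toFinset, by simpa using htop⟩
  exact hfin

/-! ### Integral elements -/

/-- In weight a + b only products of terms of weights exactly a and b can contribute: leading forms
multiply. -/
theorem weightedHomogeneousComponent_mul_of_le (φ : σ → ℝ) {p q : MvPolynomial σ K} {a b : ℝ}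
    (hp : ∀ e ∈ p.support, Finsupp.weight φ e ≤ a) (hq : ∀ e ∈ q.support, Finsupp.weight φ e ≤ b) :
    weightedHomogeneousComponent φ (a + b) (p * q) =
      weightedHomogeneousComponent φ a p * weightedHomogeneousComponent φ b q := by
  classical
  ext d
  rw [coeff_weightedHomogeneousComponent, coeff_mul, coeff_mul]
  split_ifs with hd
  · refine Finset.sum_congr rfl fun x hx => ?_
    rw [coeff_weightedHomogeneousComponent, coeff_weightedHomogeneousComponent]
    by_cases h1 : coeff x.1 p = 0
    · simp [h1]
    by_cases h2 : coeff x.2 q = 0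
    · simp [h2]
    have h3 := hp _ (mem_support_iff.2 h1)
    have h4 := hq _ (mem_support_iff.2 h2)
    rw [← Finset.HasAntidiagonal.mem_antidiagonal.1 hx, map_add] at hd
    rw [if_pos (by linarith), if_pos (by linarith)]
  · refine (Finset.sum_eq_zero fun x hx => ?_).symm
    rw [coeff_weightedHomogeneousComponent, coeff_weightedHomogeneousComponent]
    split_ifs with h1 h2
    · exact absurd (by rw [← Finset.HasAntidiagonal.mem_antidiagonal.1 hx, map_add, h1, h2]) hd
    all_goals simp

theorem weight_le_of_mem_support_mul (φ : σ → ℝ) {p q : MvPolynomial σ K} {a b : ℝ}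
    (hp : ∀ e ∈ p.support, Finsupp.weight φ e ≤ a) (hq : ∀ e ∈ q.support, Finsupp.weight φ e ≤ b) :
    ∀ e ∈ (p * q).support, Finsupp.weight φ e ≤ a + b := by
  classical
  intro e he
  obtain ⟨x, hx, y, hy, rfl⟩ := Finset.mem_add.1 (support_mul p q he)
  rw [map_add]
  exact add_le_add (hp x hx) (hq y hy)

theorem weightedHomogeneousComponent_pow_of_le (φ : σ → ℝ) {p : MvPolynomial σ K} {c : ℝ}
    (hp : ∀ e ∈ p.support, Finsupp.weight φ e ≤ c) (n : ℕ) :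
    (∀ e ∈ (p ^ n).support, Finsupp.weight φ e ≤ n * c) ∧
    weightedHomogeneousComponent φ (n * c) (p ^ n) = weightedHomogeneousComponent φ c p ^ n := by
  classical
  induction n with
  | zero =>
    have h1 : ∀ e ∈ (1 : MvPolynomial σ K).support, e = 0 := fun e he => by
      rw [mem_support_iff, coeff_one] at he
      by_contra h
      exact he (if_neg (Ne.symm h))
    refine ⟨fun e he => ?_, ?_⟩
    · rw [pow_zero] at he
      simp [h1 e he]
    · ext d
      rw [coeff_weightedHomogeneousComponent, pow_zero, pow_zero, coeff_one]
      split_ifs with h2 h3 h3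
      · rfl
      · rfl
      · exact absurd (by simp [← h3]) h2
      · rfl
  | succ n ih =>
    have h2 : ((n + 1 : ℕ) : ℝ) * c = n * c + c := by push_cast; ring
    rw [h2, pow_succ, pow_succ, ← ih.2]
    exact ⟨weight_le_of_mem_support_mul φ ih.1 hp, weightedHomogeneousComponent_mul_of_le φ ih.1 hp⟩

/-- If the top weight c of g were positive, then in a monic equation of degree n the term g^n would
alone reach weight n c, because the coefficients have nonpositive weight. The leading form of g
would then be nilpotent. -/
theorem weight_nonpos_of_isIntegral (φ : σ → ℝ) {S : AddSubmonoid (σ →₀ ℕ)}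
    (hS : ∀ e ∈ S, Finsupp.weight φ e ≤ 0) {g : MvPolynomial σ K}
    (hg : IsIntegral (supportedSubalgebra K S) g) : ∀ e ∈ g.support, Finsupp.weight φ e ≤ 0 := by
  classical
  by_contra hcon
  push Not at hcon
  obtain ⟨e₁, he₁, hpos⟩ := hcon
  obtain ⟨e₀, he₀, hmax⟩ := g.support.exists_max_image (Finsupp.weight φ) ⟨e₁, he₁⟩
  set c := Finsupp.weight φ e₀ with hc
  have hcpos : 0 < c := hpos.trans_le (hmax _ he₁)
  obtain ⟨P, hP, hPg⟩ := hg
  rw [Polynomial.eval₂_eq_sum_range, Finset.sum_range_succ, hP.coeff_natDegree, map_one,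
    one_mul] at hPg
  have h1 := congrArg (weightedHomogeneousComponent φ (P.natDegree * c)) hPg
  rw [map_add, map_sum, map_zero, (weightedHomogeneousComponent_pow_of_le φ hmax _).2,
    Finset.sum_eq_zero, zero_add] at h1
  · have h2 : coeff e₀ (weightedHomogeneousComponent φ c g) ≠ 0 := by
      rw [coeff_weightedHomogeneousComponent, if_pos hc.symm]
      exact mem_support_iff.1 he₀
    exact h2 (by rw [eq_zero_of_pow_eq_zero h1, coeff_zero])
  · intro i hi
    refine weightedHomogeneousComponent_eq_zero' _ _ fun d hd => ne_of_lt ?_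
    have h3 := weight_le_of_mem_support_mul φ (a := 0) (b := i * c)
      (fun e he => hS e ((P.coeff i).2 e he)) (weightedHomogeneousComponent_pow_of_le φ hmax i).1 d hd
    have h4 : (i : ℝ) < P.natDegree := by exact_mod_cast Finset.mem_range.1 hi
    nlinarith

open WeightedEhrhart

theorem normalization_mono {R : Type*} [CommRing R] [IsDomain R] [Algebra K R]
    {A B : Subalgebra K R} (h : A ≤ B) : normalization A ≤ normalization B := by
  rintro x ⟨hx1, hx2⟩
  refine ⟨?_, IntermediateField.adjoin.mono _ _ _ (Set.image_mono h) hx2⟩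
  have hx1' : IsIntegral A x := hx1
  obtain ⟨P, hP, hPx⟩ := hx1'
  refine ⟨P.map (Subalgebra.inclusion h).toRingHom, hP.map _, ?_⟩
  rw [Polynomial.eval₂_map]
  exact hPx

/-- The polynomial ring is integrally closed, so integral elements are polynomials, and φ excludes
each exponent outside T. -/
theorem normalization_supportedSubalgebra_le {S T : AddSubmonoid (σ →₀ ℕ)}
    (h : ∀ e ∉ T, ∃ φ : σ → ℝ, (∀ s ∈ S, Finsupp.weight φ s ≤ 0) ∧ 0 < Finsupp.weight φ e) :
    normalization (supportedSubalgebra K S) ≤ inFractions (supportedSubalgebra K T) := by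
  rintro x ⟨hx, -⟩
  have hx1 : IsIntegral (supportedSubalgebra K S) x := hx
  have hx2 : IsIntegral (MvPolynomial σ K) x := hx1.tower_top
  obtain ⟨g, rfl⟩ := IsIntegrallyClosed.isIntegral_iff.1 hx2
  have hg : IsIntegral (supportedSubalgebra K S) g :=
    (isIntegral_algebraMap_iff (IsFractionRing.injective (MvPolynomial σ K) _)).1 hx1
  refine ⟨g, fun e he => ?_, rfl⟩
  by_contra hne
  obtain ⟨φ, h1, h2⟩ := h e hne
  exact absurd (weight_nonpos_of_isIntegral φ h1 hg e he) (not_le.2 h2)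

/-- The monomial with exponent e is the quotient of those with exponents e + a and a. -/
theorem inFractions_le_normalization {S T : AddSubmonoid (σ →₀ ℕ)} (hST : S ≤ T)
    (hint : (Subalgebra.inclusion (supportedSubalgebra_mono (K := K) hST)).toRingHom.IsIntegral)
    (h : ∀ e ∈ T, ∃ a ∈ S, e + a ∈ S) :
    inFractions (supportedSubalgebra K T) ≤ normalization (supportedSubalgebra K S) := by
  rintro _ ⟨f, hf, rfl⟩
  refine ⟨?_, ?_⟩
  · have h1 : IsIntegral (supportedSubalgebra K S) f := by
      obtain ⟨P, hP, hPf⟩ := hint ⟨f, hf⟩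
      refine ⟨P, hP, ?_⟩
      have := congrArg (supportedSubalgebra K T).val hPf
      rw [map_zero] at this
      rw [← this]
      exact (Polynomial.hom_eval₂ P
        (Subalgebra.inclusion (supportedSubalgebra_mono (K := K) hST)).toRingHom
        (supportedSubalgebra K T).val.toRingHom ⟨f, hf⟩).symm
    exact h1.algebraMap
  · change algebraMap (MvPolynomial σ K) (FractionRing (MvPolynomial σ K)) f ∈
      IntermediateField.adjoin K _
    rw [f.as_sum, map_sum]
    refine sum_mem fun e he => ?_
    obtain ⟨a, ha, hea⟩ := h e (hf e he)
    have h2 : ∀ b ∈ S, ∀ c : K, algebraMap (MvPolynomial σ K) (FractionRing (MvPolynomial σ K))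
        (monomial b c) ∈ IntermediateField.adjoin K (algebraMap (MvPolynomial σ K)
          (FractionRing (MvPolynomial σ K)) '' (supportedSubalgebra K S : Set _)) :=
      fun b hb c => IntermediateField.subset_adjoin _ _
        ⟨_, monomial_mem_supportedSubalgebra hb c, rfl⟩
    have h3 : algebraMap (MvPolynomial σ K) (FractionRing (MvPolynomial σ K))
        (monomial e (coeff e f)) = algebraMap _ _ (monomial (e + a) (coeff e f)) /
          algebraMap _ _ (monomial a (1 : K)) := by
      rw [eq_div_iff, ← map_mul, monomial_mul, mul_one]
      rw [Ne, IsFractionRing.to_map_eq_zero_iff, monomial_eq_zero]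
      exact one_ne_zero
    rw [h3]
    exact div_mem (h2 _ hea _) (h2 _ ha _)

/-- If the monomial is f / g, any exponent a of g works: multiplication by a monomial only shifts
the support, so e + a is an exponent of f. -/
theorem exists_add_mem_of_mem_normalization {S : AddSubmonoid (σ →₀ ℕ)} {e : σ →₀ ℕ}
    (he : algebraMap (MvPolynomial σ K) (FractionRing (MvPolynomial σ K)) (monomial e 1) ∈
      normalization (supportedSubalgebra K S)) : ∃ a ∈ S, e + a ∈ S := by
  have h1 : algebraMap (MvPolynomial σ K) (FractionRing (MvPolynomial σ K)) (monomial e 1) ∈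
      IntermediateField.adjoin K (algebraMap (MvPolynomial σ K)
        (FractionRing (MvPolynomial σ K)) '' (supportedSubalgebra K S : Set _)) := he.2
  have h2 : Algebra.adjoin K (algebraMap (MvPolynomial σ K)
        (FractionRing (MvPolynomial σ K)) '' (supportedSubalgebra K S : Set _)) =
      inFractions (supportedSubalgebra K S) :=
    Algebra.adjoin_eq (inFractions (supportedSubalgebra K S))
  rw [IntermediateField.mem_adjoin_iff_div, h2] at h1
  obtain ⟨_, ⟨f, hf, rfl⟩, _, ⟨g, hg, rfl⟩, h3⟩ := h1
  have hne : algebraMap (MvPolynomial σ K) (FractionRing (MvPolynomial σ K)) (monomial e 1) ≠ 0 := by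
    rw [Ne, IsFractionRing.to_map_eq_zero_iff, monomial_eq_zero]
    exact one_ne_zero
  have hg0 : algebraMap (MvPolynomial σ K) (FractionRing (MvPolynomial σ K)) g ≠ 0 := by
    rintro h0
    apply hne
    rw [h3]
    exact (congrArg _ h0).trans (div_zero _)
  have h4 : monomial e (1 : K) * g = f := by
    apply IsFractionRing.injective (MvPolynomial σ K) (FractionRing (MvPolynomial σ K))
    rw [map_mul, h3]
    exact div_mul_cancel₀ _ hg0
  have hg1 : g ≠ 0 := by rintro rfl; exact hg0 (map_zero _)
  obtain ⟨a, ha⟩ := support_nonempty.2 hg1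
  refine ⟨a, hg a ha, hf _ ?_⟩
  rw [mem_support_iff, ← h4, coeff_monomial_mul, one_mul]
  exact mem_support_iff.1 ha

end Supported

/-! ### Lattice points of cones -/

theorem mem_smul_convexHull_range_iff {E : Type*} [AddCommGroup E] [Module ℝ E] {m : ℕ}
    (hm : 0 < m) (u : Fin m → E) (n : ℕ) (x : E) :
    x ∈ (n : ℝ) • convexHull ℝ (Set.range u) ↔
      ∃ μ : Fin m → ℝ, (∀ i, 0 ≤ μ i) ∧ ∑ i, μ i = n ∧ x = ∑ i, μ i • u i := by
  have hhull : convexHull ℝ (Set.range u) =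
      {x | ∃ μ : Fin m → ℝ, (∀ i, 0 ≤ μ i) ∧ ∑ i, μ i = 1 ∧ x = ∑ i, μ i • u i} := by
    have h1 : Set.range u = Fintype.linearCombination ℝ u '' Set.range
        (fun i j : Fin m => if i = j then (1 : ℝ) else 0) := by
      rw [← Set.range_comp]
      congr 1
      ext i
      simp [Fintype.linearCombination_apply]
    rw [h1, ← LinearMap.image_convexHull, convexHull_basis_eq_stdSimplex]
    ext x
    constructor
    · rintro ⟨μ, hμ, rfl⟩
      exact ⟨μ, hμ.1, hμ.2, rfl⟩
    · rintro ⟨μ, h1, h2, rfl⟩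
      exact ⟨μ, ⟨h1, h2⟩, rfl⟩
  rw [hhull, Set.mem_smul_set]
  constructor
  · rintro ⟨_, ⟨μ, h1, h2, rfl⟩, rfl⟩
    refine ⟨fun i => n * μ i, fun i => mul_nonneg n.cast_nonneg (h1 i), ?_, ?_⟩
    · rw [← Finset.mul_sum, h2, mul_one]
    · simp only [Finset.smul_sum, smul_smul]
  · rintro ⟨μ, h1, h2, rfl⟩
    -- For n = 0 one cannot divide by n. All μ i vanish then, and the origin lies in 0 • P because
    -- the hull is nonempty.
    rcases Nat.eq_zero_or_pos n with rfl | hn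
    · refine ⟨u ⟨0, hm⟩, ⟨Pi.single ⟨0, hm⟩ 1, fun i => ?_, ?_, ?_⟩, ?_⟩
      · rw [Pi.single_apply]; split_ifs <;> norm_num
      · simp
      · simp [Pi.single_apply, ite_smul]
      · rw [Nat.cast_zero, Finset.sum_eq_zero_iff_of_nonneg fun i _ => h1 i] at h2
        rw [Nat.cast_zero, zero_smul, eq_comm]
        exact Finset.sum_eq_zero fun i hi => by rw [h2 i hi, zero_smul]
    · have hn' : (n : ℝ) ≠ 0 := by positivity
      refine ⟨_, ⟨fun i => (n : ℝ)⁻¹ * μ i, fun i => by have := h1 i; positivity, ?_, rfl⟩, ?_⟩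
      · rw [← Finset.mul_sum, h2, inv_mul_cancel₀ hn']
      · simp only [Finset.smul_sum, smul_smul, mul_inv_cancel_left₀ hn']

section Cone

variable {σ : Type*} {m : ℕ} (V : Fin m → σ →₀ ℕ)

/-- The lattice points of the cone generated by the vectors `V i`. -/
def coneMonoid : AddSubmonoid (σ →₀ ℕ) where
  carrier := {e | ∃ μ : Fin m → ℝ, (∀ i, 0 ≤ μ i) ∧ ∀ t, (e t : ℝ) = ∑ i, μ i * V i t}
  zero_mem' := ⟨0, fun _ => le_rfl, fun t => by simp⟩
  add_mem' := by
    rintro a b ⟨μ, h1, h2⟩ ⟨ν, h3, h4⟩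
    refine ⟨μ + ν, fun i => add_nonneg (h1 i) (h3 i), fun t => ?_⟩
    simp [add_mul, Finset.sum_add_distrib, h2, h4]

theorem mem_coneMonoid {e : σ →₀ ℕ} : e ∈ coneMonoid V ↔
    ∃ μ : Fin m → ℝ, (∀ i, 0 ≤ μ i) ∧ ∀ t, (e t : ℝ) = ∑ i, μ i * V i t := Iff.rfl

/-- The additive monoid generated by the vectors `V i`. -/
noncomputable abbrev latticeMonoid : AddSubmonoid (σ →₀ ℕ) := AddSubmonoid.closure (Set.range V)

theorem mem_latticeMonoid {e : σ →₀ ℕ} :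
    e ∈ latticeMonoid V ↔ ∃ k : Fin m → ℕ, e = ∑ i, k i • V i := by
  rw [AddSubmonoid.mem_closure_range_iff_of_fintype]

theorem generator_mem_coneMonoid (i : Fin m) : V i ∈ coneMonoid V := by
  refine ⟨Pi.single i 1, fun j => ?_, fun t => ?_⟩
  · rw [Pi.single_apply]; split_ifs <;> norm_num
  · simp [Pi.single_apply, ite_mul]

theorem latticeMonoid_le_coneMonoid : latticeMonoid V ≤ coneMonoid V := by
  rw [latticeMonoid, AddSubmonoid.closure_le]
  rintro _ ⟨i, rfl⟩
  exact generator_mem_coneMonoid V i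

/-- The lattice points of the cone in the box spanned by the generators. -/
def coneBox : Set (σ →₀ ℕ) := {e | e ∈ coneMonoid V ∧ e ≤ ∑ i, V i}

theorem coneBox_finite : (coneBox V).Finite := by
  classical
  exact (Set.finite_Iic (∑ i, V i)).subset fun e he => he.2

theorem generator_mem_coneBox (i : Fin m) : V i ∈ coneBox V :=
  ⟨generator_mem_coneMonoid V i,
    Finset.single_le_sum (f := V) (fun _ _ => zero_le) (Finset.mem_univ i)⟩

/-- Split off the integer parts of the coefficients. The remainder has coefficients in [0, 1), so it
stays below the sum of the generators. -/
theorem exists_coneBox_add {e : σ →₀ ℕ} (he : e ∈ coneMonoid V) :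
    ∃ a ∈ coneBox V, ∃ k : Fin m → ℕ, e = a + ∑ i, k i • V i := by
  obtain ⟨μ, h1, h2⟩ := he
  have happ : ∀ t, ((∑ i, ⌊μ i⌋₊ • V i : σ →₀ ℕ) t : ℝ) = ∑ i, (⌊μ i⌋₊ : ℝ) * V i t := by
    intro t
    simp
  have hle : ∑ i, ⌊μ i⌋₊ • V i ≤ e := by
    intro t
    have : ((∑ i, ⌊μ i⌋₊ • V i : σ →₀ ℕ) t : ℝ) ≤ e t := by
      rw [happ, h2]
      exact Finset.sum_le_sum fun i _ =>
        mul_le_mul_of_nonneg_right (Nat.floor_le (h1 i)) (Nat.cast_nonneg _)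
    exact_mod_cast this
  have hval : ∀ t, ((e - ∑ i, ⌊μ i⌋₊ • V i : σ →₀ ℕ) t : ℝ) = ∑ i, (μ i - ⌊μ i⌋₊) * V i t := by
    intro t
    rw [Finsupp.tsub_apply, Nat.cast_sub (hle t), happ, h2]
    simp [sub_mul]
  refine ⟨e - ∑ i, ⌊μ i⌋₊ • V i, ⟨⟨_, fun i => sub_nonneg.2 (Nat.floor_le (h1 i)), hval⟩, ?_⟩,
    fun i => ⌊μ i⌋₊, (tsub_add_cancel_of_le hle).symm⟩
  intro t
  have : ((e - ∑ i, ⌊μ i⌋₊ • V i : σ →₀ ℕ) t : ℝ) ≤ ((∑ i, V i : σ →₀ ℕ) t : ℝ) := by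
    rw [hval, Finsupp.finsetSum_apply]
    push_cast
    refine Finset.sum_le_sum fun i _ => mul_le_of_le_one_left (Nat.cast_nonneg _) ?_
    linarith [Nat.lt_floor_add_one (μ i)]
  exact_mod_cast this

theorem coneMonoid_eq_closure_coneBox : coneMonoid V = AddSubmonoid.closure (coneBox V) := by
  apply le_antisymm
  · intro e he
    obtain ⟨a, ha, k, rfl⟩ := exists_coneBox_add V he
    refine add_mem (AddSubmonoid.subset_closure ha) (sum_mem fun i _ => nsmul_mem ?_ _)
    exact AddSubmonoid.subset_closure (generator_mem_coneBox V i)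
  · rw [AddSubmonoid.closure_le]
    exact fun e he => he.1

/-- At height t₀ = 1 the cone is a polytope, hence closed. An affine separation there becomes a
linear one by moving the constant into the coordinate t₀. -/
theorem exists_weight_separating [Fintype σ] (t₀ : σ) (hV : ∀ i, V i t₀ = 1) {e : σ →₀ ℕ}
    (he : e ∉ coneMonoid V) : ∃ φ : σ → ℝ, (∀ s ∈ coneMonoid V, Finsupp.weight φ s ≤ 0) ∧
      0 < Finsupp.weight φ e := by
  classical
  have hw : ∀ (φ : σ → ℝ) (e : σ →₀ ℕ), Finsupp.weight φ e = ∑ t, (e t : ℝ) * φ t := by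
    intro φ e
    simp [Finsupp.weight_eq_sum]
  -- it is enough to control the generators
  suffices h : ∃ φ : σ → ℝ, (∀ i, Finsupp.weight φ (V i) ≤ 0) ∧ 0 < Finsupp.weight φ e by
    obtain ⟨φ, h1, h2⟩ := h
    refine ⟨φ, ?_, h2⟩
    rintro s ⟨μ, h3, h4⟩
    have : Finsupp.weight φ s = ∑ i, μ i * Finsupp.weight φ (V i) := by
      simp only [hw, h4, Finset.sum_mul, Finset.mul_sum]
      rw [Finset.sum_comm]
      simp only [mul_assoc]
    rw [this]
    exact Finset.sum_nonpos fun i _ => mul_nonpos_of_nonneg_of_nonpos (h3 i) (h1 i)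
  have hsplit : ∀ (g : σ → ℝ) (u : ℝ) (e : σ →₀ ℕ),
      Finsupp.weight (fun t => g t - if t = t₀ then u else 0) e =
        ∑ t, (e t : ℝ) * g t - e t₀ * u := by
    intro g u e
    simp [hw, mul_sub]
  rcases Nat.eq_zero_or_pos (e t₀) with h0 | hpos
  -- A point at height 0 cannot be rescaled to height 1. Pairing with e is positive on e itself, and
  -- subtracting a large multiple of the height makes it nonpositive on the generators.
  · have hne : e ≠ 0 := by rintro rfl; exact he (zero_mem _)
    refine ⟨fun t => e t - if t = t₀ then ∑ i, ∑ t, (V i t : ℝ) * e t else 0, fun i => ?_, ?_⟩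
    · rw [hsplit, hV, Nat.cast_one, one_mul, sub_nonpos]
      exact Finset.single_le_sum (f := fun i => ∑ t, (V i t : ℝ) * e t)
        (fun i _ => Finset.sum_nonneg fun t _ => by positivity) (Finset.mem_univ i)
    · rw [hsplit, h0, Nat.cast_zero, zero_mul, sub_zero]
      obtain ⟨t, ht⟩ := Finsupp.ne_iff.1 hne
      refine Finset.sum_pos' (fun t _ => by positivity) ⟨t, Finset.mem_univ t, ?_⟩
      have : 0 < e t := Nat.pos_of_ne_zero ht
      positivity
  · have hx : (fun t => (e t₀ : ℝ)⁻¹ * e t) ∉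
        convexHull ℝ (Set.range fun i => (fun t => (V i t : ℝ))) := by
      intro hx
      have hpos' : (e t₀ : ℝ) ≠ 0 := by positivity
      have hm : 0 < m := by
        rcases Nat.eq_zero_or_pos m with rfl | h
        · simp at hx
        · exact h
      have := Set.smul_mem_smul_set (a := (e t₀ : ℝ)) hx
      rw [mem_smul_convexHull_range_iff hm] at this
      obtain ⟨μ, h1, -, h3⟩ := this
      refine he ⟨μ, h1, fun t => ?_⟩
      have := congrFun h3 t
      simpa [mul_inv_cancel_left₀ hpos'] using this
    obtain ⟨f, u, h1, h2⟩ := geometric_hahn_banach_closed_point (convex_convexHull ℝ _)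
      ((Set.finite_range _).isClosed_convexHull ℝ) hx
    have hf : ∀ x : σ → ℝ, f x = ∑ t, x t * f (Pi.single t 1) := fun x => by
      refine ((f : (σ → ℝ) →ₗ[ℝ] ℝ).pi_apply_eq_sum_univ x).trans
        (Finset.sum_congr rfl fun t _ => ?_)
      have : (fun j => if t = j then (1 : ℝ) else 0) = Pi.single t 1 := by
        ext j
        simp [Pi.single_apply, eq_comm]
      rw [this]
      rfl
    refine ⟨fun t => f (Pi.single t 1) - if t = t₀ then u else 0, fun i => ?_, ?_⟩
    · rw [hsplit, hV, Nat.cast_one, one_mul, sub_nonpos, ← hf fun t => (V i t : ℝ)]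
      exact (h1 _ (subset_convexHull ℝ _ ⟨i, rfl⟩)).le
    · rw [hsplit, ← hf fun t => (e t : ℝ), sub_pos]
      have h3 : (fun t => (e t₀ : ℝ)⁻¹ * e t) = (e t₀ : ℝ)⁻¹ • fun t => (e t : ℝ) := rfl
      rw [h3, map_smul, smul_eq_mul] at h2
      have hpos' : (0 : ℝ) < e t₀ := by exact_mod_cast hpos
      rwa [inv_mul_eq_div, lt_div_iff₀' hpos'] at h2

end Cone

/-! ### The matrix of generators -/

section Generators

open MvPolynomial

variable {τ : Type*} [Fintype τ] {m : ℕ} (W : Fin m → τ →₀ ℕ)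

/-- The integer matrix whose columns are the vectors `W i`. -/
def generatorMatrix : Matrix τ (Fin m) ℤ := fun t i => (W i t : ℤ)

omit [Fintype τ] in
theorem mem_span_col_of_mem_coneMonoid {e : τ →₀ ℕ} (he : e ∈ coneMonoid W) :
    (fun t => (((e t : ℕ) : ℤ) : ℝ)) ∈
      Submodule.span ℝ (Set.range ((generatorMatrix W).map (Int.cast : ℤ → ℝ)).col) := by
  obtain ⟨μ, -, h⟩ := he
  rw [Submodule.mem_span_range_iff_exists_fun]
  refine ⟨μ, ?_⟩
  ext t
  simp [h, generatorMatrix, Matrix.col]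

/-- The coordinates, scaled by the minor, of a vector with respect to the columns of a
nonvanishing minor. -/
noncomputable def cramerCoord (r : Fin (intRank (generatorMatrix W)) → τ)
    (c : Fin (intRank (generatorMatrix W)) → Fin m) (e : τ →₀ ℕ) :
    Fin (intRank (generatorMatrix W)) → ℤ :=
  ((generatorMatrix W).submatrix r c).adjugate.mulVec fun j => (e (r j) : ℤ)

theorem abs_mulVec_le {k : ℕ} (A : Matrix (Fin k) (Fin k) ℤ) (y : Fin k → ℤ) {b : ℤ}
    (hy : ∀ l, |y l| ≤ b) (j : Fin k) : |A.mulVec y j| ≤ b * ∑ j, ∑ l, |A j l| := by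
  have hb : 0 ≤ b := (abs_nonneg _).trans (hy j)
  have h1 : A.mulVec y j = ∑ l, A j l * y l := rfl
  rw [h1]
  calc |∑ l, A j l * y l| ≤ ∑ l, |A j l * y l| := Finset.abs_sum_le_sum_abs _ _
    _ ≤ ∑ l, b * |A j l| := by
        refine Finset.sum_le_sum fun l _ => ?_
        rw [abs_mul, mul_comm]
        exact mul_le_mul_of_nonneg_right (hy l) (abs_nonneg _)
    _ = b * ∑ l, |A j l| := (Finset.mul_sum _ _ _).symm
    _ ≤ b * ∑ j, ∑ l, |A j l| := mul_le_mul_of_nonneg_left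
        (Finset.single_le_sum (f := fun j => ∑ l, |A j l|)
          (fun j _ => Finset.sum_nonneg fun l _ => abs_nonneg _) (Finset.mem_univ j)) hb

variable {W} in
theorem minor_mul_eq_sum_cramerCoord {r : Fin (intRank (generatorMatrix W)) → τ}
    {c : Fin (intRank (generatorMatrix W)) → Fin m}
    (h : ((generatorMatrix W).submatrix r c).det ≠ 0) {e : τ →₀ ℕ} (he : e ∈ coneMonoid W) (t : τ) :
    ((generatorMatrix W).submatrix r c).det * (e t : ℤ) =
      ∑ j, (W (c j) t : ℤ) * cramerCoord W r c e j :=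
  minor_smul_eq_sum (generatorMatrix W) r c h (fun t => (e t : ℤ))
    (mem_span_col_of_mem_coneMonoid W he) t

omit [Fintype τ] in
variable {W} in
theorem sum_smul_injective_of_minor_ne_zero {k : ℕ} {r : Fin k → τ} {c : Fin k → Fin m}
    (h : ((generatorMatrix W).submatrix r c).det ≠ 0) :
    Function.Injective fun a : Fin k → ℕ => ∑ j, a j • W (c j) := by
  intro a b hab
  have h1 := Matrix.linearIndependent_cols_of_det_ne_zero h
  rw [Fintype.linearIndependent_iff] at h1
  have h2 := h1 (fun j => (a j : ℤ) - b j) (by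
    ext t
    have h3 := congrArg (fun e : τ →₀ ℕ => ((e (r t) : ℕ) : ℤ)) hab
    simp only [Finsupp.finsetSum_apply, Finsupp.smul_apply, smul_eq_mul, Nat.cast_sum,
      Nat.cast_mul] at h3
    simp only [Finset.sum_apply, Pi.smul_apply, smul_eq_mul, Pi.zero_apply, sub_mul,
      Finset.sum_sub_distrib]
    exact sub_eq_zero.2 h3)
  ext j
  have := h2 j
  omega

/-! ### Growth of the number of lattice points -/

variable {W} in
theorem apply_le_mul_of_mem_coneMonoid (t₀ : τ) (hW : ∀ i, W i t₀ = 1) {x : τ →₀ ℕ}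
    (hx : x ∈ coneMonoid W) (t : τ) : x t ≤ x t₀ * ∑ i, ∑ t, W i t := by
  obtain ⟨μ, h1, h2⟩ := hx
  have : (x t : ℝ) ≤ x t₀ * ∑ i, ∑ t, W i t := by
    rw [h2 t, h2 t₀, Finset.sum_mul]
    refine Finset.sum_le_sum fun i _ => ?_
    rw [hW, Nat.cast_one, mul_one]
    refine mul_le_mul_of_nonneg_left ?_ (h1 i)
    have h3 : W i t ≤ ∑ i, ∑ t, W i t :=
      (Finset.single_le_sum (f := fun t => W i t) (fun _ _ => Nat.zero_le _)
        (Finset.mem_univ t)).trans (Finset.single_le_sum (f := fun i => ∑ t, W i t)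
        (fun _ _ => Nat.zero_le _) (Finset.mem_univ i))
    exact_mod_cast h3
  exact_mod_cast this

variable {W} in
theorem finite_setOf_mem_and_apply_eq (t₀ : τ) (hW : ∀ i, W i t₀ = 1) {A : AddSubmonoid (τ →₀ ℕ)}
    (hAC : A ≤ coneMonoid W) (n : ℕ) : {x | x ∈ A ∧ x t₀ = n}.Finite := by
  classical
  refine (Set.finite_Iic (Finsupp.equivFunOnFinite.symm fun _ => n * ∑ i, ∑ t, W i t)).subset ?_
  rintro x ⟨hx, rfl⟩ t
  exact apply_le_mul_of_mem_coneMonoid t₀ hW (hAC hx) t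

-- Take d + 1 independent generators, choose d coefficients freely in [0, q] with q = ⌊n/(d+1)⌋, and
-- let the remaining one fill up the height to n. This gives (q+1)^d distinct points, and q + 1 ≥
-- n/(d+1).
variable {W} in
theorem le_ncard_of_latticeMonoid_le (t₀ : τ) (hW : ∀ i, W i t₀ = 1) {d : ℕ}
    (hd : intRank (generatorMatrix W) = d + 1) {A : AddSubmonoid (τ →₀ ℕ)}
    (hLA : latticeMonoid W ≤ A) (hAC : A ≤ coneMonoid W) (n : ℕ) :
    (1 / (d + 1 : ℚ)) ^ d * (n : ℚ) ^ d ≤ ({x | x ∈ A ∧ x t₀ = n}.ncard : ℚ) := by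
  classical
  have hfin := finite_setOf_mem_and_apply_eq t₀ hW hAC n
  obtain ⟨r, c, hdet⟩ := exists_minor_ne_zero (generatorMatrix W)
  let c' : Fin (d + 1) → Fin m := fun j => c (Fin.cast hd.symm j)
  have hinj : Function.Injective fun a : Fin (d + 1) → ℕ => ∑ j, a j • W (c' j) := by
    intro a b hab
    have h1 := sum_smul_injective_of_minor_ne_zero hdet
      (a₁ := fun j => a (Fin.cast hd j)) (a₂ := fun j => b (Fin.cast hd j)) (by
        simp only
        rw [← (finCongr hd.symm).sum_comp, ← (finCongr hd.symm).sum_comp]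
        exact hab)
    ext j
    exact congrFun h1 (Fin.cast hd.symm j)
  set q := n / (d + 1) with hq
  let ψ : (Fin d → Fin (q + 1)) → τ →₀ ℕ := fun a =>
    ∑ j, (Fin.cons (n - ∑ i, (a i : ℕ)) (fun i => (a i : ℕ)) : Fin (d + 1) → ℕ) j • W (c' j)
  have hψ : Function.Injective ψ := by
    intro a b hab
    have h1 := hinj hab
    rw [Fin.cons_inj] at h1
    ext i
    exact congrFun h1.2 i
  have hmem : Set.range ψ ⊆ {x | x ∈ A ∧ x t₀ = n} := by
    rintro _ ⟨a, rfl⟩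
    refine ⟨hLA (sum_mem fun j _ => nsmul_mem
      (AddSubmonoid.subset_closure (Set.mem_range_self (c' j))) _), ?_⟩
    have hle : ∑ i, (a i : ℕ) ≤ n := by
      calc ∑ i, (a i : ℕ) ≤ ∑ _i : Fin d, q :=
            Finset.sum_le_sum fun i _ => Nat.lt_succ_iff.1 (a i).2
        _ = d * q := by simp
        _ ≤ (d + 1) * q := by gcongr; omega
        _ ≤ n := Nat.mul_div_le n (d + 1)
    have h1 : ∀ b : Fin (d + 1) → ℕ, (∑ j, b j • W (c' j) : τ →₀ ℕ) t₀ = ∑ j, b j := by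
      intro b
      simp [hW]
    rw [h1, Fin.sum_univ_succ]
    simp only [Fin.cons_zero, Fin.cons_succ]
    omega
  have h1 : (q + 1) ^ d ≤ {x | x ∈ A ∧ x t₀ = n}.ncard := by
    have h2 := Set.ncard_le_ncard hmem hfin
    rwa [← Set.image_univ, Set.ncard_image_of_injective _ hψ, Set.ncard_univ,
      Nat.card_eq_fintype_card, Fintype.card_fun, Fintype.card_fin, Fintype.card_fin] at h2
  calc (1 / (d + 1 : ℚ)) ^ d * (n : ℚ) ^ d = (n / (d + 1 : ℚ)) ^ d := by
        rw [← mul_pow, one_div_mul_eq_div]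
    _ ≤ ((q + 1 : ℕ) : ℚ) ^ d := by
        gcongr
        rw [div_le_iff₀ (by positivity)]
        have : n < (q + 1) * (d + 1) := by
          rw [hq, mul_comm]; exact Nat.lt_mul_div_succ n (Nat.succ_pos d)
        exact_mod_cast this.le
    _ ≤ _ := by exact_mod_cast h1

-- A point is determined by its d + 1 Cramer coordinates, integers of size at most n N. At height n
-- they sum to Δ n, since all generators have height 1, so d of them suffice.
variable {W} in
theorem exists_ncard_le_of_le_coneMonoid (t₀ : τ) (hW : ∀ i, W i t₀ = 1) {d : ℕ}
    (hd : intRank (generatorMatrix W) = d + 1) {A : AddSubmonoid (τ →₀ ℕ)}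
    (hAC : A ≤ coneMonoid W) :
    ∃ C : ℚ, ∀ n : ℕ, ({x | x ∈ A ∧ x t₀ = n}.ncard : ℚ) ≤ C * ((n : ℚ) + 1) ^ d := by
  classical
  obtain ⟨r, c, hdet⟩ := exists_minor_ne_zero (generatorMatrix W)
  have hbox : ∀ n : ℕ, ∀ x ∈ {x | x ∈ A ∧ x t₀ = n}, ∀ t, x t ≤ n * ∑ i, ∑ t, W i t := by
    rintro n x ⟨hx, rfl⟩ t
    exact apply_le_mul_of_mem_coneMonoid t₀ hW (hAC hx) t
  set Δ := ((generatorMatrix W).submatrix r c).det with hΔ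
  set M : ℕ := ∑ i, ∑ t, W i t
  obtain ⟨N, hN⟩ : ∃ N : ℤ, N = M * ∑ j, ∑ l, |((generatorMatrix W).submatrix r c).adjugate j l| :=
    ⟨_, rfl⟩
  have hN0 : 0 ≤ N := by
    rw [hN]
    exact mul_nonneg (Nat.cast_nonneg _)
      (Finset.sum_nonneg fun j _ => Finset.sum_nonneg fun l _ => abs_nonneg _)
  have hz : ∀ n : ℕ, ∀ x ∈ {x | x ∈ A ∧ x t₀ = n}, ∀ j, |cramerCoord W r c x j| ≤ n * N := by
    intro n x hx j
    rw [hN, ← mul_assoc]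
    refine abs_mulVec_le _ _ (fun l => ?_) j
    rw [Nat.abs_cast]
    exact_mod_cast hbox n x hx (r l)
  refine ⟨((2 * N + 1 : ℤ) : ℚ) ^ d, fun n => ?_⟩
  let f : (τ →₀ ℕ) → Fin d → ℤ := fun x j => cramerCoord W r c x (Fin.cast hd.symm j.succ)
  have hinj : Set.InjOn f {x | x ∈ A ∧ x t₀ = n} := by
    intro x hx y hy hxy
    have hsum : ∀ x ∈ {x | x ∈ A ∧ x t₀ = n},
        cramerCoord W r c x (Fin.cast hd.symm 0) + ∑ j, f x j = Δ * n := by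
      intro x hx
      have h1 := minor_mul_eq_sum_cramerCoord hdet (hAC hx.1) t₀
      simp only [hW, Nat.cast_one, one_mul] at h1
      rw [hx.2, ← hΔ, ← (finCongr hd.symm).sum_comp, Fin.sum_univ_succ] at h1
      exact h1.symm
    have h0 : cramerCoord W r c x (Fin.cast hd.symm 0) =
        cramerCoord W r c y (Fin.cast hd.symm 0) := by
      have h1 := hsum x hx
      have h2 := hsum y hy
      rw [hxy] at h1
      linarith
    have hall : cramerCoord W r c x = cramerCoord W r c y := by
      ext j
      obtain ⟨j, rfl⟩ := (finCongr hd.symm).surjective j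
      refine Fin.cases h0 (fun i => ?_) j
      exact congrFun hxy i
    ext t
    have h1 := minor_mul_eq_sum_cramerCoord hdet (hAC hx.1) t
    rw [hall, ← minor_mul_eq_sum_cramerCoord hdet (hAC hy.1) t] at h1
    exact_mod_cast mul_left_cancel₀ hdet h1
  have hmaps : f '' {x | x ∈ A ∧ x t₀ = n} ⊆
      (Fintype.piFinset fun _ : Fin d => Finset.Icc (-(n * N)) (n * N) : Finset (Fin d → ℤ)) := by
    rintro _ ⟨x, hx, rfl⟩
    rw [Finset.mem_coe, Fintype.mem_piFinset]
    intro j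
    rw [Finset.mem_Icc]
    exact abs_le.1 (hz n x hx _)
  have h1 := Set.ncard_le_ncard hmaps (Finset.finite_toSet _)
  rw [hinj.ncard_image, Set.ncard_coe_finset, Fintype.card_piFinset_const,
    Int.card_Icc] at h1
  have h2 : ((n * N + 1 - -(n * N)).toNat : ℤ) = 2 * (n * N) + 1 := by
    have := mul_nonneg (Int.natCast_nonneg n) hN0
    rw [Int.toNat_of_nonneg (by linarith)]
    ring
  have h3 : ((n * N + 1 - -(n * N)).toNat : ℚ) = 2 * (n * N) + 1 := by exact_mod_cast h2
  calc ({x | x ∈ A ∧ x t₀ = n}.ncard : ℚ) ≤ ((n * N + 1 - -(n * N)).toNat : ℚ) ^ d := by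
        exact_mod_cast h1
    _ ≤ (((2 * N + 1 : ℤ) : ℚ) * (n + 1)) ^ d := by
        rw [h3]
        have hN0' : (0 : ℚ) ≤ N := by exact_mod_cast hN0
        push_cast
        gcongr
        nlinarith [(Nat.cast_nonneg n : (0 : ℚ) ≤ n)]
    _ = _ := by rw [mul_pow]

/-! ### Saturation in terms of the cone -/

/-- Write e as an integral combination of the generators and move the negative part to the other
side. -/
theorem exists_add_mem_latticeMonoid_of_gcd [DecidableEq τ]
    (h : WeightedEhrhart.maximalMinorGcd (generatorMatrix W) = 1) {e : τ →₀ ℕ}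
    (he : e ∈ coneMonoid W) : ∃ a ∈ latticeMonoid W, e + a ∈ latticeMonoid W := by
  have h1 := mem_span_col_of_maximalMinorGcd_eq_one _ h (fun t => (e t : ℤ))
    (mem_span_col_of_mem_coneMonoid W he)
  rw [Submodule.mem_span_range_iff_exists_fun] at h1
  obtain ⟨z, hz⟩ := h1
  refine ⟨∑ i, (-(z i)).toNat • W i, (mem_latticeMonoid W).2 ⟨_, rfl⟩,
    (mem_latticeMonoid W).2 ⟨fun i => (z i).toNat, ?_⟩⟩
  ext t
  have h2 := congrFun hz t
  simp only [Finset.sum_apply, Pi.smul_apply, smul_eq_mul] at h2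
  have h3 : (((e + ∑ i, (-(z i)).toNat • W i : τ →₀ ℕ) t : ℕ) : ℤ) =
      ((∑ i, (z i).toNat • W i : τ →₀ ℕ) t : ℕ) := by
    simp only [Finsupp.add_apply, Finsupp.finsetSum_apply, Finsupp.smul_apply, smul_eq_mul,
      Nat.cast_add, Nat.cast_sum, Nat.cast_mul, ← h2]
    rw [← Finset.sum_add_distrib]
    refine Finset.sum_congr rfl fun i _ => ?_
    have h4 : ((z i).toNat : ℤ) - ((-(z i)).toNat : ℤ) = z i := Int.toNat_sub_toNat_neg _
    change z i * (W i t : ℤ) + _ = _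
    rw [← add_mul]
    congr 1
    linarith
  exact_mod_cast h3

/-- To prove saturation, let d x = ∑ z_i W_i. Adding ∑ |z_i| W_i moves x into the cone, since z_i /
d ≥ -|z_i|; there the hypothesis makes it a difference of elements of the monoid. -/
theorem maximalMinorGcd_eq_one_of_exists_add_mem [DecidableEq τ]
    (h : ∀ e ∈ coneMonoid W, ∃ a ∈ latticeMonoid W, e + a ∈ latticeMonoid W) :
    WeightedEhrhart.maximalMinorGcd (generatorMatrix W) = 1 := by
  have hmem : ∀ e ∈ latticeMonoid W, (fun t => (e t : ℤ)) ∈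
      Submodule.span ℤ (Set.range (generatorMatrix W).col) := by
    intro e he
    obtain ⟨k, rfl⟩ := (mem_latticeMonoid W).1 he
    rw [Submodule.mem_span_range_iff_exists_fun]
    refine ⟨fun i => k i, ?_⟩
    ext t
    simp [generatorMatrix, Matrix.col]
  refine maximalMinorGcd_eq_one_of_saturated _ fun d x hd hx => ?_
  rw [Submodule.mem_span_range_iff_exists_fun] at hx
  obtain ⟨z, hz⟩ := hx
  have hzt : ∀ t, (x t : ℝ) = ∑ i, (z i / d : ℝ) * W i t := by
    intro t
    have h1 := congrFun hz t
    simp only [Finset.sum_apply, Pi.smul_apply, smul_eq_mul] at h1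
    have h2 : (∑ i, (z i : ℝ) * W i t) = d * x t := by
      have := congrArg (Int.cast : ℤ → ℝ) h1
      push_cast at this
      exact this
    have hd' : (d : ℝ) ≠ 0 := by exact_mod_cast hd
    simp only [div_mul_eq_mul_div]
    rw [← Finset.sum_div, h2, mul_div_cancel_left₀ _ hd']
  have hcoef : ∀ i, (0 : ℝ) ≤ z i / d + (z i).natAbs := by
    intro i
    have h1 : |(z i / d : ℝ)| ≤ (z i).natAbs := by
      rw [abs_div, Nat.cast_natAbs, Int.cast_abs]
      refine div_le_self (abs_nonneg _) ?_
      exact_mod_cast Int.one_le_abs hd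
    linarith [neg_abs_le (z i / d : ℝ)]
  set b : τ →₀ ℕ := ∑ i, (z i).natAbs • W i with hb
  have hbt : ∀ t, (b t : ℝ) = ∑ i, ((z i).natAbs : ℝ) * W i t := by
    intro t
    simp [hb]
  have hsum : ∀ t, (x t : ℝ) + b t = ∑ i, (z i / d + (z i).natAbs : ℝ) * W i t := by
    intro t
    rw [hzt, hbt, ← Finset.sum_add_distrib]
    exact Finset.sum_congr rfl fun i _ => by ring
  have hnn : ∀ t, 0 ≤ x t + b t := by
    intro t
    have : (0 : ℝ) ≤ x t + b t := by
      rw [hsum]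
      exact Finset.sum_nonneg fun i _ => mul_nonneg (hcoef i) (Nat.cast_nonneg _)
    exact_mod_cast this
  set e : τ →₀ ℕ := Finsupp.equivFunOnFinite.symm fun t => (x t + b t).toNat
  have het : ∀ t, (e t : ℤ) = x t + b t := fun t => Int.toNat_of_nonneg (hnn t)
  obtain ⟨a, ha, hea⟩ := h e ⟨_, hcoef, fun t => by
    rw [← hsum]
    exact_mod_cast het t⟩
  have h1 : x = (fun t => ((e + a) t : ℤ)) - (fun t => (a t : ℤ)) - fun t => (b t : ℤ) := by
    ext t
    simp [het]
  rw [h1]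
  refine Submodule.sub_mem _ (Submodule.sub_mem _ (hmem _ hea) (hmem _ ha)) (hmem _ ?_)
  exact (mem_latticeMonoid W).2 ⟨_, rfl⟩

end Generators

/-! ### Transcendence bases of monomial algebras -/

section TranscendenceBasis

open MvPolynomial

variable (K : Type*) [Field K] {τ : Type*}

theorem prod_monomial_pow {k : ℕ} (u : Fin k → τ →₀ ℕ) (a : Fin k → ℕ) :
    ∏ j, (monomial (u j) (1 : K)) ^ a j = monomial (∑ j, a j • u j) 1 := by
  simp only [monomial_pow, one_pow, monomial_sum_one]

/-- Substitution sends distinct monomials to distinct monomials, so no terms can cancel. -/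
theorem algebraicIndependent_monomial {k : ℕ} (u : Fin k → τ →₀ ℕ)
    (hu : Function.Injective fun a : Fin k → ℕ => ∑ j, a j • u j) :
    AlgebraicIndependent K fun j => monomial (u j) (1 : K) := by
  classical
  rw [algebraicIndependent_iff]
  intro p hp
  ext a
  rw [coeff_zero]
  have h1 : aeval (fun j => monomial (u j) (1 : K)) p =
      ∑ b ∈ p.support, monomial (∑ j, b j • u j) (coeff b p) := by
    conv_lhs => rw [p.as_sum, map_sum]
    refine Finset.sum_congr rfl fun b _ => ?_
    rw [aeval_monomial, Finsupp.prod_fintype _ _ fun _ => pow_zero _, prod_monomial_pow,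
      algebraMap_eq, C_mul_monomial, mul_one]
  have h2 := congrArg (coeff (∑ j, a j • u j)) (h1.symm.trans hp)
  rw [coeff_sum, coeff_zero] at h2
  simp only [coeff_monomial] at h2
  by_contra hne
  rw [Finset.sum_eq_single a] at h2
  · rw [if_pos rfl] at h2
    exact hne h2
  · intro b _ hb
    exact if_neg fun h => hb (DFunLike.coe_injective (hu h))
  · intro ha
    exact absurd (mem_support_iff.2 hne) ha

theorem isAlgebraic_of_pow_mul_eq {R A : Type*} [CommRing R] [CommRing A] [Algebra R A] {x : A}
    {D : ℕ} (hD : 0 < D) (a b : R) (ha : a ≠ 0) (h : algebraMap R A a * x ^ D = algebraMap R A b) :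
    IsAlgebraic R x := by
  refine ⟨Polynomial.C a * Polynomial.X ^ D - Polynomial.C b, fun h0 => ha ?_, ?_⟩
  · have h1 := congrArg (fun p => Polynomial.coeff p D) h0
    simpa [Polynomial.coeff_C, hD.ne'] using h1
  · simp [h]

variable {K}

/-- The relation among exponents says that the D-th power of a monomial, times a monomial in the u
j, is another such monomial. Hence monomials, and so their sums, are algebraic. -/
theorem isTranscendenceBasis_monomial {k : ℕ} (u : Fin k → τ →₀ ℕ)
    (hu : Function.Injective fun a : Fin k → ℕ => ∑ j, a j • u j) (A : AddSubmonoid (τ →₀ ℕ))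
    (huA : ∀ j, u j ∈ A)
    (h : ∀ e ∈ A, ∃ D : ℕ, 0 < D ∧ ∃ a b : Fin k → ℕ,
      D • e + ∑ j, a j • u j = ∑ j, b j • u j) :
    IsTranscendenceBasis K fun j => (⟨monomial (u j) 1,
      monomial_mem_supportedSubalgebra (huA j) 1⟩ : supportedSubalgebra K A) := by
  classical
  set x : Fin k → supportedSubalgebra K A := fun j => ⟨monomial (u j) 1,
    monomial_mem_supportedSubalgebra (huA j) 1⟩ with hx
  rw [isTranscendenceBasis_iff_algebraicIndependent_isAlgebraic]
  refine ⟨?_, ⟨fun f => ?_⟩⟩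
  · rw [← AlgHom.algebraicIndependent_iff (supportedSubalgebra K A).val Subtype.val_injective]
    exact algebraicIndependent_monomial K u hu
  · have hmono : ∀ e (he : e ∈ A) (c : K), IsAlgebraic (Algebra.adjoin K (Set.range x))
        (⟨monomial e c, monomial_mem_supportedSubalgebra he c⟩ : supportedSubalgebra K A) := by
      intro e he c
      obtain ⟨D, hD, a, b, hab⟩ := h e he
      let X : Fin k → Algebra.adjoin K (Set.range x) := fun j =>
        ⟨x j, Algebra.subset_adjoin ⟨j, rfl⟩⟩
      have hX : ∀ a : Fin k → ℕ, (((∏ j, X j ^ a j : Algebra.adjoin K (Set.range x)) :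
          supportedSubalgebra K A) : MvPolynomial τ K) = monomial (∑ j, a j • u j) 1 := by
        intro a
        rw [← prod_monomial_pow]
        push_cast
        rfl
      refine isAlgebraic_of_pow_mul_eq hD (∏ j, X j ^ a j) (c ^ D • ∏ j, X j ^ b j) ?_ ?_
      · intro h0
        have h1 := hX a
        rw [h0] at h1
        exact one_ne_zero (monomial_eq_zero.1 h1.symm)
      · apply Subtype.ext
        have h1 : (((c ^ D • ∏ j, X j ^ b j : Algebra.adjoin K (Set.range x)) :
            supportedSubalgebra K A) : MvPolynomial τ K) = monomial (∑ j, b j • u j) (c ^ D) := by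
          refine (congrArg (fun p => c ^ D • p) (hX b)).trans ?_
          rw [smul_monomial, smul_eq_mul, mul_one]
        refine Eq.trans ?_ h1.symm
        refine (congrArg (fun p => p * (monomial e c) ^ D) (hX a)).trans ?_
        rw [monomial_pow, monomial_mul, one_mul, add_comm, hab]
    have hsum : f = ∑ e ∈ f.1.support.attach,
        ⟨monomial e.1 (coeff e.1 f.1), monomial_mem_supportedSubalgebra (f.2 e.1 e.2) _⟩ := by
      apply Subtype.ext
      rw [AddSubmonoidClass.coe_finsetSum]
      refine f.1.as_sum.trans ?_
      exact (Finset.sum_attach f.1.support fun e => monomial e (coeff e f.1)).symm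
    rw [hsum]
    have := (Subalgebra.algebraicClosure (Algebra.adjoin K (Set.range x))
      (supportedSubalgebra K A)).sum_mem (t := f.1.support.attach) (f := fun e =>
        ⟨monomial e.1 (coeff e.1 f.1), monomial_mem_supportedSubalgebra (f.2 e.1 e.2) _⟩)
        fun e _ => hmono _ (f.2 e.1 e.2) _
    exact this

end TranscendenceBasis

/-! ### Krull dimension as the rank of the generators -/

section Dimension

open MvPolynomial

variable {K : Type*} [Field K] {τ : Type*} [Fintype τ] {m : ℕ} {W : Fin m → τ →₀ ℕ}

theorem ringKrullDim_supportedSubalgebra {A : AddSubmonoid (τ →₀ ℕ)}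
    (hLA : latticeMonoid W ≤ A) (hAC : A ≤ coneMonoid W)
    [Algebra.FiniteType K (supportedSubalgebra K A)] :
    ringKrullDim (supportedSubalgebra K A) = (intRank (generatorMatrix W) : WithBot ℕ∞) := by
  obtain ⟨r, c, hdet⟩ := exists_minor_ne_zero (generatorMatrix W)
  refine ringKrullDim_eq_of_isTranscendenceBasis (isTranscendenceBasis_monomial
    (fun j => W (c j)) (sum_smul_injective_of_minor_ne_zero hdet) A
    (fun j => hLA (AddSubmonoid.subset_closure ⟨_, rfl⟩)) fun e he => ?_)
  set Δ := ((generatorMatrix W).submatrix r c).det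
  -- Cramer's rule is multiplied by the sign of Δ, and the integral coefficients are split into
  -- positive and negative parts, because exponents must be natural.
  refine ⟨Δ.natAbs, Int.natAbs_pos.2 hdet,
    fun j => (-(Δ.sign * cramerCoord W r c e j)).toNat,
    fun j => (Δ.sign * cramerCoord W r c e j).toNat, ?_⟩
  ext t
  have h1 := minor_mul_eq_sum_cramerCoord hdet (hAC he) t
  have h2 : (((Δ.natAbs • e + ∑ j, (-(Δ.sign * cramerCoord W r c e j)).toNat • W (c j) :
      τ →₀ ℕ) t : ℕ) : ℤ) =
      ((∑ j, (Δ.sign * cramerCoord W r c e j).toNat • W (c j) : τ →₀ ℕ) t : ℕ) := by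
    simp only [Finsupp.add_apply, Finsupp.finsetSum_apply, Finsupp.smul_apply, smul_eq_mul,
      Nat.cast_add, Nat.cast_sum, Nat.cast_mul]
    have h3 : (Δ.natAbs : ℤ) * (e t : ℤ) =
        ∑ j, (Δ.sign * cramerCoord W r c e j) * (W (c j) t : ℤ) := by
      rw [Int.natCast_natAbs, ← Int.sign_mul_self_eq_abs, mul_assoc, h1, Finset.mul_sum]
      exact Finset.sum_congr rfl fun j _ => by ring
    rw [h3, ← Finset.sum_add_distrib]
    refine Finset.sum_congr rfl fun j _ => ?_
    have h4 := Int.toNat_sub_toNat_neg (Δ.sign * cramerCoord W r c e j)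
    rw [← add_mul]
    congr 1
    linarith
  exact_mod_cast h2

end Dimension

namespace WeightedEhrhart

open MvPolynomial

/-! ### Exponents of monomials -/

section Exponents

variable {K : Type*} [Field K] {q : ℕ}

/-- The exponent of the monomial `y^b z^n`. -/
noncomputable def expVec (b : Fin q → ℕ) (n : ℕ) : Option (Fin q) →₀ ℕ :=
  Finsupp.equivFunOnFinite.symm fun o => o.elim n b

@[simp] theorem expVec_some (b : Fin q → ℕ) (n : ℕ) (i : Fin q) : expVec b n (some i) = b i := rfl

@[simp] theorem expVec_none (b : Fin q → ℕ) (n : ℕ) : expVec b n none = n := rfl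

theorem expVec_eta (e : Option (Fin q) →₀ ℕ) : expVec (fun i => e (some i)) (e none) = e := by
  ext o
  cases o <;> rfl

theorem yz_eq_monomial (b : Fin q → ℕ) (n : ℕ) : yz K b n = monomial (expVec b n) 1 := rfl

theorem natVec_injective : Function.Injective (natVec : (Fin q → ℕ) → Fin q → ℝ) := by
  intro a b h
  ext i
  exact Nat.cast_injective (R := ℝ) (congrFun h i)

/-- The exponents of the monomials `y^x z^n` with `(x, n) ∈ E`. -/
def expSet (E : Set ((Fin q → ℝ) × ℕ)) : Set (Option (Fin q) →₀ ℕ) :=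
  {e | (natVec fun i => e (some i), e none) ∈ E}

theorem monomialAlgebra_eq (E : Set ((Fin q → ℝ) × ℕ)) :
    monomialAlgebra K E = supportedSubalgebra K (AddSubmonoid.closure (expSet E)) := by
  rw [← adjoin_monomial_eq_supportedSubalgebra, monomialAlgebra]
  congr 1
  ext f
  constructor
  · rintro ⟨b, n, h, rfl⟩
    exact ⟨expVec b n, h, rfl⟩
  · rintro ⟨e, he, rfl⟩
    exact ⟨_, _, he, by rw [yz_eq_monomial, expVec_eta]⟩

theorem monomial_mem_monomialAlgebra {E : Set ((Fin q → ℝ) × ℕ)} {e : Option (Fin q) →₀ ℕ}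
    (he : e ∈ expSet E) (c : K) : monomial e c ∈ monomialAlgebra K E := by
  rw [monomialAlgebra_eq]
  exact monomial_mem_supportedSubalgebra (AddSubmonoid.subset_closure he) c

theorem monomialAlgebra_eq_of_expSet_eq {E : Set ((Fin q → ℝ) × ℕ)}
    {A : AddSubmonoid (Option (Fin q) →₀ ℕ)} (h : expSet E = A) :
    monomialAlgebra K E = supportedSubalgebra K A := by
  rw [monomialAlgebra_eq, h, AddSubmonoid.closure_eq]

theorem monomialAlgebra_fg {E : Set ((Fin q → ℝ) × ℕ)} {F : Set (Option (Fin q) →₀ ℕ)}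
    (hF : F.Finite) (h : expSet E = AddSubmonoid.closure F) : (monomialAlgebra K E).FG := by
  rw [monomialAlgebra_eq_of_expSet_eq h, ← adjoin_monomial_eq_supportedSubalgebra]
  exact ⟨(hF.image _).toFinset, by rw [Set.Finite.coe_toFinset]⟩

/-! ### The grading -/

theorem map_monomialPiece (E : Set ((Fin q → ℝ) × ℕ)) (n : ℕ) :
    (monomialPiece K E n).map (monomialAlgebra K E).val.toLinearMap =
      restrictSupport K {e | e ∈ expSet E ∧ e none = n} := by
  rw [monomialPiece, Submodule.map_span, restrictSupport_eq_span]
  congr 1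
  ext f
  constructor
  · rintro ⟨g, ⟨b, hb, hg⟩, rfl⟩
    exact ⟨expVec b n, ⟨hb, rfl⟩, hg.symm⟩
  · rintro ⟨e, ⟨he, rfl⟩, rfl⟩
    exact ⟨⟨monomial e 1, monomial_mem_monomialAlgebra he 1⟩,
      ⟨_, he, by rw [yz_eq_monomial, expVec_eta]⟩, rfl⟩

theorem mem_monomialPiece {E : Set ((Fin q → ℝ) × ℕ)} {n : ℕ} {f : monomialAlgebra K E} :
    f ∈ monomialPiece K E n ↔
      ∀ e ∈ (f : PolyRing K q).support, e ∈ expSet E ∧ e none = n := by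
  have h : f ∈ monomialPiece K E n ↔
      (f : PolyRing K q) ∈ (monomialPiece K E n).map (monomialAlgebra K E).val.toLinearMap :=
    (Function.Injective.mem_set_image (f := (monomialAlgebra K E).val.toLinearMap)
      Subtype.val_injective).symm
  rw [h, map_monomialPiece, mem_restrictSupport_iff]
  rfl

variable {E : Set ((Fin q → ℝ) × ℕ)} {A : AddSubmonoid (Option (Fin q) →₀ ℕ)}

/-- The exponents must form a monoid: each piece contains only monomials from E itself, so products
must not leave E. -/
theorem gradedMonoid_monomialPiece (h : expSet E = A) :
    SetLike.GradedMonoid (monomialPiece K E) := by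
  classical
  refine { one_mem := ?_, mul_mem := ?_ }
  · rw [mem_monomialPiece]
    intro e he
    have h1 : e = 0 := by
      by_contra hne
      refine mem_support_iff.1 he ?_
      rw [OneMemClass.coe_one, coeff_one, if_neg (Ne.symm hne)]
    rw [h1, h]
    exact ⟨A.zero_mem, rfl⟩
  · intro i j f g hf hg
    rw [mem_monomialPiece] at hf hg ⊢
    intro e he
    obtain ⟨a, ha, b, hb, rfl⟩ := Finset.mem_add.1 (support_mul _ _ he)
    have h1 := hf a ha
    have h2 := hg b hb
    rw [h] at h1 h2 ⊢
    exact ⟨A.add_mem h1.1 h2.1, by rw [Finsupp.add_apply, h1.2, h2.2]⟩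

theorem isInternal_monomialPiece (h : expSet E = A) :
    DirectSum.IsInternal (monomialPiece K E) := by
  classical
  rw [DirectSum.isInternal_submodule_iff_iSupIndep_and_iSup_eq_top]
  constructor
  · intro n
    rw [Submodule.disjoint_def]
    intro f hf hf'
    have h1 : ⨆ j, ⨆ (_ : j ≠ n), monomialPiece K E j ≤
        (restrictSupport K {e : Option (Fin q) →₀ ℕ | e none ≠ n}).comap
          (monomialAlgebra K E).val.toLinearMap := by
      refine iSup_le fun j => iSup_le fun hj g hg => ?_
      rw [mem_monomialPiece] at hg
      rw [Submodule.mem_comap, mem_restrictSupport_iff]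
      intro e he
      rw [Set.mem_ofPred_eq, (hg e he).2]
      exact hj
    have h2 := h1 hf'
    rw [Submodule.mem_comap, mem_restrictSupport_iff] at h2
    rw [mem_monomialPiece] at hf
    apply Subtype.ext
    rw [ZeroMemClass.coe_zero, ← support_eq_empty, Finset.eq_empty_iff_forall_notMem]
    exact fun e he => h2 he (hf e he).2
  · rw [eq_top_iff]
    rintro f -
    have hf : ∀ e ∈ (f : PolyRing K q).support, e ∈ expSet E := by
      have : (f : PolyRing K q) ∈ supportedSubalgebra K A :=
        (monomialAlgebra_eq_of_expSet_eq (K := K) h).le f.2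
      rw [h]
      exact this
    have hsum : f = ∑ e ∈ (f : PolyRing K q).support.attach,
        ⟨monomial e.1 (coeff e.1 (f : PolyRing K q)),
          monomial_mem_monomialAlgebra (hf e.1 e.2) _⟩ := by
      apply Subtype.ext
      rw [AddSubmonoidClass.coe_finsetSum]
      refine (f : PolyRing K q).as_sum.trans ?_
      exact (Finset.sum_attach (f : PolyRing K q).support
        fun e => monomial e (coeff e (f : PolyRing K q))).symm
    rw [hsum]
    refine Submodule.sum_mem _ fun e _ => Submodule.mem_iSup_of_mem (e.1 none) ?_
    rw [mem_monomialPiece]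
    intro e' he'
    rw [Finset.mem_singleton.1 (support_monomial_subset he')]
    exact ⟨hf e.1 e.2, rfl⟩

/-- A graded piece of a monomial algebra has a basis of monomials. -/
noncomputable def monomialPieceEquiv (E : Set ((Fin q → ℝ) × ℕ)) (n : ℕ) :
    monomialPiece K E n ≃ₗ[K] restrictSupport K {e | e ∈ expSet E ∧ e none = n} :=
  (Submodule.equivMapOfInjective (monomialAlgebra K E).val.toLinearMap Subtype.val_injective
    (monomialPiece K E n)).trans (LinearEquiv.ofEq _ _ (map_monomialPiece E n))

theorem finite_monomialPiece {n : ℕ} (h : {e | e ∈ expSet E ∧ e none = n}.Finite) :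
    Module.Finite K (monomialPiece K E n) := by
  have := h.to_subtype
  have : Module.Finite K (restrictSupport K {e | e ∈ expSet E ∧ e none = n}) :=
    Module.Finite.of_basis (basisRestrictSupport K _)
  exact Module.Finite.equiv (monomialPieceEquiv E n).symm

theorem finrank_monomialPiece (n : ℕ) :
    Module.finrank K (monomialPiece K E n) = {e | e ∈ expSet E ∧ e none = n}.ncard := by
  rw [(monomialPieceEquiv E n).finrank_eq, Module.finrank_eq_nat_card_basis
    (basisRestrictSupport K _)]
  rfl

end Exponents

/-! ### Exponents of weighted Ehrhart rings -/

section Translation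

/-- The additive map on exponents given by a matrix of natural numbers. -/
noncomputable def matrixHom {σ τ : Type*} [Fintype σ] [Fintype τ] (C : Matrix τ σ ℕ) :
    (σ →₀ ℕ) →+ (τ →₀ ℕ) where
  toFun e := Finsupp.equivFunOnFinite.symm (C.mulVec e)
  map_zero' := by ext t; simp
  map_add' a b := by ext t; simp [Matrix.mulVec_add]

theorem matrixHom_apply {σ τ : Type*} [Fintype σ] [Fintype τ] (C : Matrix τ σ ℕ) (e : σ →₀ ℕ)
    (t : τ) : matrixHom C e t = ∑ s, C t s * e s := rfl

theorem map_coneMonoid_le {σ τ : Type*} [Fintype σ] [Fintype τ] (C : Matrix τ σ ℕ) {m : ℕ}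
    (V : Fin m → σ →₀ ℕ) :
    (coneMonoid V).map (matrixHom C) ≤ coneMonoid fun i => matrixHom C (V i) := by
  rintro _ ⟨e, ⟨μ, h1, h2⟩, rfl⟩
  refine ⟨μ, h1, fun t => ?_⟩
  simp only [matrixHom_apply, Nat.cast_sum, Nat.cast_mul, h2, Finset.mul_sum]
  rw [Finset.sum_comm]
  exact Finset.sum_congr rfl fun i _ => Finset.sum_congr rfl fun s _ => by ring

theorem latticeMonoid_le_map {σ τ : Type*} {m : ℕ} (g : (σ →₀ ℕ) →+ (τ →₀ ℕ))
    (V : Fin m → σ →₀ ℕ) : (latticeMonoid fun i => g (V i)) ≤ (coneMonoid V).map g := by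
  rw [latticeMonoid, AddSubmonoid.closure_le]
  rintro _ ⟨i, rfl⟩
  exact ⟨V i, generator_mem_coneMonoid V i, rfl⟩

variable {q m : ℕ} (hm : 0 < m) (u : Fin m → Fin q → ℕ)

-- The generators have last coordinate 1, so the cone equation at `none` says that the coefficients
-- sum to n.
include hm in
theorem expSet_ehrhartExponents :
    expSet (ehrhartExponents (convexHull ℝ (Set.range fun i => natVec (u i)))) =
      coneMonoid fun i => expVec (u i) 1 := by
  ext e
  have h1 : e ∈ expSet (ehrhartExponents (convexHull ℝ (Set.range fun i => natVec (u i)))) ↔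
      natVec (fun i => e (some i)) ∈
        ((e none : ℕ) : ℝ) • convexHull ℝ (Set.range fun i => natVec (u i)) :=
    ⟨fun h => h.1, fun h => ⟨h, fun i => ⟨e (some i), by simp [natVec]⟩⟩⟩
  rw [h1, mem_smul_convexHull_range_iff hm, SetLike.mem_coe, mem_coneMonoid]
  refine exists_congr fun μ => and_congr_right fun _ => ?_
  constructor
  · rintro ⟨h2, h3⟩ t
    cases t with
    | none => simp [h2]
    | some i => simpa [natVec] using congrFun h3 i
  · intro h2
    refine ⟨by simpa using (h2 none).symm, ?_⟩
    ext i
    simpa [natVec] using h2 (some i)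

include hm in
theorem exists_natVec_eq_of_mem_latticePoints {x : Fin q → ℝ} {n : ℕ}
    (hx : x ∈ latticePoints (convexHull ℝ (Set.range fun i => natVec (u i))) n) :
    ∃ b, x = natVec b := by
  obtain ⟨h1, h2⟩ := hx
  rw [mem_smul_convexHull_range_iff hm] at h1
  obtain ⟨μ, h3, -, rfl⟩ := h1
  choose k hk using h2
  refine ⟨fun i => (k i).toNat, ?_⟩
  ext i
  have h4 : (0 : ℝ) ≤ k i := by
    rw [← hk, Finset.sum_apply]
    exact Finset.sum_nonneg fun j _ => mul_nonneg (h3 j) (Nat.cast_nonneg _)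
  have h5 : ((k i).toNat : ℤ) = k i := Int.toNat_of_nonneg (by exact_mod_cast h4)
  rw [hk, natVec]
  exact_mod_cast h5.symm

variable {p : ℕ} (w : (Fin q → ℝ) →ₗ[ℝ] (Fin p → ℝ)) (a : Fin p → Fin q → ℕ)

/-- The matrix of `(x, n) ↦ (w(x), n)`. -/
def weightMatrix (a : Fin p → Fin q → ℕ) : Matrix (Option (Fin p)) (Option (Fin q)) ℕ :=
  fun i j => match i, j with
    | none, none => 1
    | none, some _ => 0
    | some _, none => 0
    | some i, some j => a i j

theorem matrixHom_weightMatrix_none (e : Option (Fin q) →₀ ℕ) :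
    matrixHom (weightMatrix a) e none = e none := by
  rw [matrixHom_apply, Fintype.sum_option]
  simp [weightMatrix]

theorem matrixHom_weightMatrix_some (e : Option (Fin q) →₀ ℕ) (i : Fin p) :
    matrixHom (weightMatrix a) e (some i) = ∑ j, a i j * e (some j) := by
  rw [matrixHom_apply, Fintype.sum_option]
  simp [weightMatrix]

variable {w a} (hwa : ∀ i j, w (Pi.single j 1) i = (a i j : ℝ))

include hwa in
theorem apply_natVec (e : Option (Fin q) →₀ ℕ) :
    w (natVec fun j => e (some j)) = natVec fun i => matrixHom (weightMatrix a) e (some i) := by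
  ext i
  have h1 : natVec (fun j => e (some j)) = ∑ j, (e (some j) : ℝ) • Pi.single j (1 : ℝ) := by
    ext j
    simp [natVec, Finset.sum_apply, Pi.single_apply]
  rw [h1, map_sum, Finset.sum_apply, natVec, matrixHom_weightMatrix_some]
  push_cast
  refine Finset.sum_congr rfl fun j _ => ?_
  rw [map_smul, Pi.smul_apply, smul_eq_mul, hwa, mul_comm]

include hm hwa in
theorem expSet_weightedExponents :
    expSet (weightedExponents w (convexHull ℝ (Set.range fun i => natVec (u i)))) =
      (coneMonoid fun i => expVec (u i) 1).map (matrixHom (weightMatrix a)) := by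
  ext e
  constructor
  · rintro ⟨x, hx, hxe⟩
    obtain ⟨b, rfl⟩ := exists_natVec_eq_of_mem_latticePoints hm u hx
    refine ⟨expVec b (e none), ?_, ?_⟩
    · rw [← expSet_ehrhartExponents hm u]
      exact hx
    · have h1 := apply_natVec hwa (expVec b (e none))
      ext t
      cases t with
      | none => rw [matrixHom_weightMatrix_none, expVec_none]
      | some i => exact congrFun (natVec_injective (h1.symm.trans hxe)) i
  · rintro ⟨e, he, rfl⟩
    rw [← expSet_ehrhartExponents hm u] at he
    refine ⟨natVec fun i => e (some i), ?_, apply_natVec hwa e⟩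
    rw [matrixHom_weightMatrix_none]
    exact he

include hm hwa in
theorem image_latticePoints (n : ℕ) :
    w '' latticePoints (convexHull ℝ (Set.range fun i => natVec (u i))) n =
      (fun e : Option (Fin p) →₀ ℕ => natVec fun i => e (some i)) ''
        {e | e ∈ expSet (weightedExponents w (convexHull ℝ (Set.range fun i => natVec (u i)))) ∧
          e none = n} := by
  ext y
  constructor
  · rintro ⟨x, hx, rfl⟩
    obtain ⟨b, rfl⟩ := exists_natVec_eq_of_mem_latticePoints hm u hx
    have h1 := apply_natVec hwa (expVec b n)
    refine ⟨matrixHom (weightMatrix a) (expVec b n), ⟨?_, ?_⟩, h1.symm⟩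
    · refine ⟨natVec b, ?_, h1⟩
      rw [matrixHom_weightMatrix_none]
      exact hx
    · rw [matrixHom_weightMatrix_none, expVec_none]
  · rintro ⟨e, ⟨he, rfl⟩, rfl⟩
    exact he

theorem injOn_natVec_some (n : ℕ) (E : Set (Option (Fin p) →₀ ℕ)) :
    Set.InjOn (fun e : Option (Fin p) →₀ ℕ => natVec fun i => e (some i))
      {e | e ∈ E ∧ e none = n} := by
  rintro e ⟨-, h1⟩ e' ⟨-, h2⟩ h
  rw [← expVec_eta e, ← expVec_eta e', h1, h2, natVec_injective h]

include hwa in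
theorem image_convexHull_eq :
    w '' convexHull ℝ (Set.range fun i => natVec (u i)) = convexHull ℝ (Set.range fun i =>
      natVec fun j => matrixHom (weightMatrix a) (expVec (u i) 1) (some j)) := by
  rw [LinearMap.image_convexHull, ← Set.range_comp]
  congr 2
  ext1 i
  exact apply_natVec hwa (expVec (u i) 1)

/-- The monoid of exponents of finitely many monomials. -/
theorem expSet_range {ι : Type*} (f : ι → Option (Fin q) →₀ ℕ) :
    expSet (Set.range fun i => (natVec fun j => f i (some j), f i none)) = Set.range f := by
  ext e
  constructor
  · rintro ⟨i, hi⟩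
    rw [Prod.mk.injEq] at hi
    refine ⟨i, ?_⟩
    rw [← expVec_eta e, ← expVec_eta (f i), hi.2, natVec_injective hi.1]
  · rintro ⟨i, rfl⟩
    exact ⟨i, rfl⟩

end Translation

/-! ### From monoids to the statements about rings -/

theorem exists_finite_inclusion {K : Type*} [Field K] {σ : Type*}
    {S T : AddSubmonoid (σ →₀ ℕ)} {A B : Subalgebra K (MvPolynomial σ K)}
    (hA : A = supportedSubalgebra K S) (hB : B = supportedSubalgebra K T) (hST : S ≤ T)
    {F : Set (σ →₀ ℕ)} (hF : F.Finite) (hFT : F ⊆ T) (h : ∀ e ∈ T, ∃ a ∈ F, ∃ b ∈ S, e = a + b) :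
    ∃ hAB : A ≤ B, (Subalgebra.inclusion hAB).toRingHom.Finite ∧
      (Subalgebra.inclusion hAB).toRingHom.IsIntegral := by
  subst hA hB
  have hfin := inclusion_supportedSubalgebra_finite (K := K) hST hF hFT h
  exact ⟨supportedSubalgebra_mono hST, hfin, hfin.to_isIntegral⟩

theorem intRank_generatorMatrix_pos {τ : Type*} [Fintype τ] {m : ℕ} (hm : 0 < m)
    {W : Fin m → τ →₀ ℕ} (t₀ : τ) (hW : ∀ i, W i t₀ = 1) : 0 < intRank (generatorMatrix W) := by
  refine le_rank_of_det_submatrix_ne_zero (k := 1) _ (fun _ => t₀) (fun _ => ⟨0, hm⟩) ?_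
  simp [generatorMatrix, hW]

theorem hilbert_of_monoids {τ : Type*} [Fintype τ] {m : ℕ} {W : Fin m → τ →₀ ℕ} (t₀ : τ)
    (hW : ∀ i, W i t₀ = 1) {A : AddSubmonoid (τ →₀ ℕ)} (hLA : latticeMonoid W ≤ A)
    (hAC : A ≤ coneMonoid W) {F : Set (τ →₀ ℕ)} (hF : F.Finite) (hFA : F ⊆ A)
    (hA : ∀ e ∈ A, ∃ a ∈ F, ∃ k : Fin m → ℕ, e = a + ∑ i, k i • W i) {d : ℕ}
    (hd : intRank (generatorMatrix W) = d + 1) (H : ℕ → ℕ)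
    (hH : ∀ n, H n = {x | x ∈ A ∧ x t₀ = n}.ncard) :
    (∃ f : Polynomial ℚ, f.degree = (d : WithBot ℕ) ∧
      ∀ᶠ n : ℕ in Filter.atTop, (H n : ℚ) = f.eval (n : ℚ)) ∧
    (∃ h : Polynomial ℤ, h.eval 1 ≠ 0 ∧
      PowerSeries.mk (fun n => (H n : ℤ)) * (1 - PowerSeries.X) ^ (d + 1) =
        (h : PowerSeries ℤ)) := by
  obtain ⟨r, g, -, hg⟩ := hF.fin_param
  obtain ⟨h, hh⟩ := exists_polynomial_count (Finsupp.applyAddHom t₀ : (τ →₀ ℕ) →+ ℕ) g W hW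
  obtain ⟨C, hC⟩ := exists_ncard_le_of_le_coneMonoid t₀ hW hd hAC
  have hset : ∀ n, {x | (∃ j, ∃ k : Fin m → ℕ, x = g j + ∑ i, k i • W i) ∧
      (Finsupp.applyAddHom t₀ : (τ →₀ ℕ) →+ ℕ) x = n} = {x | x ∈ A ∧ x t₀ = n} := by
    intro n
    ext x
    refine and_congr_left fun _ => ⟨?_, fun hx => ?_⟩
    · rintro ⟨j, k, rfl⟩
      refine add_mem (hFA (hg ▸ ⟨j, rfl⟩)) (hLA ((mem_latticeMonoid W).2 ⟨k, rfl⟩))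
    · obtain ⟨a, ha, k, rfl⟩ := hA x hx
      rw [← hg] at ha
      obtain ⟨j, rfl⟩ := ha
      exact ⟨j, k, rfl⟩
  simp only [hset, ← hH] at hh
  refine exists_hilbert_polynomial_of_growth H m d h hh ((1 / (d + 1 : ℚ)) ^ d) C (by positivity)
    (fun n => ?_) fun n => ?_
  · rw [hH]
    exact le_ncard_of_latticeMonoid_le t₀ hW hd hLA hAC n
  · rw [hH]
    exact hC n

/-- The ring of the cone is always integral over that of the generators, so the only obstruction to
equality is the field of fractions, which the gcd controls. -/
theorem normalization_eq_iff_gcd {K : Type*} [Field K] {τ : Type*} [Fintype τ] [DecidableEq τ]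
    {m : ℕ} {W : Fin m → τ →₀ ℕ} (t₀ : τ) (hW : ∀ i, W i t₀ = 1) {A : AddSubmonoid (τ →₀ ℕ)}
    (hLA : latticeMonoid W ≤ A) (hAC : A ≤ coneMonoid W) :
    normalization (supportedSubalgebra K (latticeMonoid W)) ≤
      normalization (supportedSubalgebra K A) ∧
    normalization (supportedSubalgebra K A) ≤ inFractions (supportedSubalgebra K (coneMonoid W)) ∧
    ((normalization (supportedSubalgebra K (latticeMonoid W)) =
        normalization (supportedSubalgebra K A) ∧
      normalization (supportedSubalgebra K A) =
        inFractions (supportedSubalgebra K (coneMonoid W))) ↔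
      maximalMinorGcd (generatorMatrix W) = 1) := by
  have h1 : normalization (supportedSubalgebra K (latticeMonoid W)) ≤
      normalization (supportedSubalgebra K A) := normalization_mono (supportedSubalgebra_mono hLA)
  have h2 : normalization (supportedSubalgebra K A) ≤
      inFractions (supportedSubalgebra K (coneMonoid W)) :=
    normalization_supportedSubalgebra_le fun e he => by
      obtain ⟨φ, h3, h4⟩ := exists_weight_separating W t₀ hW he
      exact ⟨φ, fun s hs => h3 s (hAC hs), h4⟩
  refine ⟨h1, h2, fun ⟨h3, h4⟩ => ?_, fun h3 => ?_⟩
  · refine maximalMinorGcd_eq_one_of_exists_add_mem W fun e he => ?_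
    refine exists_add_mem_of_mem_normalization (K := K) ?_
    rw [h3, h4]
    exact ⟨monomial e 1, monomial_mem_supportedSubalgebra he 1, rfl⟩
  · have hfin := inclusion_supportedSubalgebra_finite (K := K) (latticeMonoid_le_coneMonoid W)
      (coneBox_finite W) (fun e he => he.1) fun e he => by
        obtain ⟨b, hb, k, rfl⟩ := exists_coneBox_add W he
        exact ⟨b, hb, _, (mem_latticeMonoid W).2 ⟨k, rfl⟩, rfl⟩
    have h4 := inFractions_le_normalization (latticeMonoid_le_coneMonoid W) hfin.to_isIntegral
      fun e he => exists_add_mem_latticeMonoid_of_gcd W h3 he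
    exact ⟨le_antisymm h1 (h2.trans h4), le_antisymm h2 (h4.trans h1)⟩

end WeightedEhrhart

open WeightedEhrhart in
theorem theorem4p1 (K : Type*) [Field K] (s p m : ℕ) (hm : 0 < m)
    (v : Fin m → Fin s → ℕ)
    (P : Set (Fin s → ℝ)) (hP : P = convexHull ℝ (Set.range fun i => natVec (v i)))
    (w : (Fin s → ℝ) →ₗ[ℝ] (Fin p → ℝ))
    (hw : ∀ (i : Fin p) (j : Fin s), ∃ k : ℕ, w (Pi.single j 1) i = (k : ℝ))
    (B : Matrix (Option (Fin p)) (Fin m) ℤ)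
    (hB : ∀ j : Fin m, (∀ i : Fin p, (B (some i) j : ℝ) = w (natVec (v j)) i) ∧ B none j = 1) :
    -- (a) `A^w(P)` is the direct sum of the `A^w(P)_n`, as a graded algebra
    (SetLike.GradedMonoid (weightedEhrhartPiece K w P) ∧
      DirectSum.IsInternal (weightedEhrhartPiece K w P)) ∧
    -- (b) the Hilbert function
    (∀ n : ℕ, (w '' latticePoints P n).Finite ∧
      Module.Finite K (weightedEhrhartPiece K w P n) ∧
      hilbertFun K w P n = (w '' latticePoints P n).ncard) ∧
    -- (c) finitely many monomial generators
    (∃ (r : ℕ) (c : Fin r → Fin s → ℕ) (d : Fin r → ℕ),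
      (∀ i, yz K (c i) (d i) ∈ ehrhartRing K P) ∧
      ehrhartRing K P = monomialAlgebra K (Set.range fun i => (natVec (c i), d i)) ∧
      weightedEhrhartRing K w P =
        monomialAlgebra K (Set.range fun i => (w (natVec (c i)), d i))) ∧
    (weightedEhrhartRing K w P).FG ∧
    -- (d) a finite integral extension
    (∃ hL : vertexAlgebra K w v ≤ weightedEhrhartRing K w P,
      (Subalgebra.inclusion hL).toRingHom.Finite ∧
      (Subalgebra.inclusion hL).toRingHom.IsIntegral) ∧
    -- (e) the normalizations
    (normalization (vertexAlgebra K w v) ≤ normalization (weightedEhrhartRing K w P) ∧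
      normalization (weightedEhrhartRing K w P) ≤ inFractions (ehrhartRing K (w '' P)) ∧
      ((normalization (vertexAlgebra K w v) = normalization (weightedEhrhartRing K w P) ∧
          normalization (weightedEhrhartRing K w P) = inFractions (ehrhartRing K (w '' P))) ↔
        maximalMinorGcd B = 1)) ∧
    -- (f) the Hilbert polynomial and the Hilbert series, where `δ + 1 = dim A^w(P)`
    (∃ δ : ℕ, ringKrullDim (weightedEhrhartRing K w P) = ((δ + 1 : ℕ) : WithBot ℕ∞) ∧
      (∃ f : Polynomial ℚ, f.degree = (δ : WithBot ℕ) ∧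
        ∀ᶠ n : ℕ in Filter.atTop, (hilbertFun K w P n : ℚ) = f.eval (n : ℚ)) ∧
      (∃ h : Polynomial ℤ, h.eval 1 ≠ 0 ∧
        PowerSeries.mk (fun n => (hilbertFun K w P n : ℤ)) * (1 - PowerSeries.X) ^ (δ + 1) =
          (h : PowerSeries ℤ))) := by
  subst hP
  choose a ha using hw
  set V : Fin m → Option (Fin s) →₀ ℕ := fun i => expVec (v i) 1
  set g := matrixHom (weightMatrix a)
  set W : Fin m → Option (Fin p) →₀ ℕ := fun i => g (V i)
  set A := (coneMonoid V).map g
  have hW : ∀ i, W i none = 1 := fun i => matrixHom_weightMatrix_none a (V i)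
  have hLA : latticeMonoid W ≤ A := latticeMonoid_le_map g V
  have hAC : A ≤ coneMonoid W := map_coneMonoid_le _ V
  have hE := expSet_weightedExponents hm v ha
  have hwv : ∀ e : Option (Fin s) →₀ ℕ, w (natVec fun j => e (some j)) =
    natVec fun i => g e (some i) := apply_natVec ha
  have hring : weightedEhrhartRing K w (convexHull ℝ (Set.range fun i => natVec (v i))) =
      supportedSubalgebra K A := monomialAlgebra_eq_of_expSet_eq hE
  have hring' : ehrhartRing K (convexHull ℝ (Set.range fun i => natVec (v i))) =
      supportedSubalgebra K (coneMonoid V) :=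
    monomialAlgebra_eq_of_expSet_eq (expSet_ehrhartExponents hm v)
  have hvertex : vertexAlgebra K w v = supportedSubalgebra K (latticeMonoid W) := by
    have h1 : (fun i => (w (natVec (v i)), 1)) =
        fun i => ((natVec fun j => W i (some j), W i none) : (Fin p → ℝ) × ℕ) := by
      ext1 i
      rw [hW]
      exact Prod.ext (hwv (V i)) rfl
    rw [vertexAlgebra, h1, monomialAlgebra_eq, expSet_range]
  have hcone : ehrhartRing K (w '' convexHull ℝ (Set.range fun i => natVec (v i))) =
      supportedSubalgebra K (coneMonoid W) := by
    rw [image_convexHull_eq v ha]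
    refine monomialAlgebra_eq_of_expSet_eq ((expSet_ehrhartExponents hm _).trans ?_)
    congr 2
    ext1 i
    have h1 := expVec_eta (W i)
    rw [hW] at h1
    exact h1
  have hBW : B = generatorMatrix W := by
    ext t i
    cases t with
    | none => rw [(hB i).2, generatorMatrix, hW, Nat.cast_one]
    | some j =>
      have h1 := (hB i).1 j
      have h2 : w (natVec (v i)) = natVec fun j => W i (some j) := hwv (V i)
      rw [h2] at h1
      have h3 : (B (some j) i : ℝ) = ((W i (some j) : ℕ) : ℝ) := h1
      change B (some j) i = ((W i (some j) : ℕ) : ℤ)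
      exact_mod_cast h3
  have hfinset := finite_setOf_mem_and_apply_eq none hW hAC
  have himage := image_latticePoints hm v ha
  rw [hE] at himage
  have hilb : ∀ n, hilbertFun K w (convexHull ℝ (Set.range fun i => natVec (v i))) n =
      {x | x ∈ A ∧ x none = n}.ncard := by
    intro n
    refine (finrank_monomialPiece n).trans ?_
    rw [hE]
    rfl
  have hFfin : (g '' coneBox V).Finite := (coneBox_finite V).image g
  have hFA : g '' coneBox V ⊆ A := by
    rintro _ ⟨e, he, rfl⟩
    exact ⟨e, he.1, rfl⟩
  -- The decomposition is made upstairs, in the cone over P, and carried down by g; A itself need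
  -- not be all lattice points of a cone.
  have hAF : ∀ e ∈ A, ∃ x ∈ g '' coneBox V, ∃ k : Fin m → ℕ, e = x + ∑ i, k i • W i := by
    rintro _ ⟨e, he, rfl⟩
    obtain ⟨b, hb, k, rfl⟩ := exists_coneBox_add V he
    exact ⟨g b, ⟨b, hb, rfl⟩, k, by rw [map_add, map_sum]; simp only [map_nsmul, W]⟩
  have hAcl : A = AddSubmonoid.closure (g '' coneBox V) := by
    rw [← AddMonoidHom.map_mclosure, ← coneMonoid_eq_closure_coneBox]
  have hfg : (weightedEhrhartRing K w (convexHull ℝ (Set.range fun i => natVec (v i)))).FG :=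
    monomialAlgebra_fg hFfin (hE.trans (congrArg _ hAcl))
  refine ⟨⟨gradedMonoid_monomialPiece hE, isInternal_monomialPiece hE⟩, fun n => ⟨?_, ?_, ?_⟩, ?_,
    hfg, ?_, ?_, ?_⟩
  · rw [himage]
    exact (hfinset n).image _
  · refine finite_monomialPiece ?_
    rw [hE]
    exact hfinset n
  · rw [hilb, himage, (injOn_natVec_some n _).ncard_image]
    rfl
  · obtain ⟨r, f, -, hf⟩ := (coneBox_finite V).fin_param
    refine ⟨r, fun i j => f i (some j), fun i => f i none, fun i => ?_, ?_, ?_⟩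
    · rw [hring', yz_eq_monomial, expVec_eta]
      exact monomial_mem_supportedSubalgebra (hf.le ⟨i, rfl⟩).1 1
    · rw [hring', monomialAlgebra_eq, expSet_range, hf, ← coneMonoid_eq_closure_coneBox]
    · have h1 : (fun i => (w (natVec fun j => f i (some j)), f i none)) =
          fun i => ((natVec fun j => g (f i) (some j), g (f i) none) : (Fin p → ℝ) × ℕ) := by
        ext1 i
        exact Prod.ext (hwv (f i)) (matrixHom_weightMatrix_none a (f i)).symm
      rw [hring, h1, monomialAlgebra_eq, expSet_range (fun i => g (f i)), hAcl, ← hf,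
        ← Set.range_comp]
      rfl
  · refine exists_finite_inclusion hvertex hring hLA hFfin hFA fun e he => ?_
    obtain ⟨x, hx, k, rfl⟩ := hAF e he
    exact ⟨x, hx, _, (mem_latticeMonoid W).2 ⟨k, rfl⟩, rfl⟩
  · rw [hvertex, hring, hcone, hBW]
    exact normalization_eq_iff_gcd none hW hLA hAC
  -- The row of ones makes the rank positive, so it can be written δ + 1.
  · obtain ⟨δ, hδ⟩ := Nat.exists_eq_succ_of_ne_zero (intRank_generatorMatrix_pos hm none hW).ne'
    refine ⟨δ, ?_, hilbert_of_monoids none hW hLA hAC hFfin hFA hAF hδ _ hilb⟩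
    rw [hring] at hfg ⊢
    have : Algebra.FiniteType K (supportedSubalgebra K A) :=
      (Subalgebra.fg_iff_finiteType _).1 hfg
    rw [ringKrullDim_supportedSubalgebra hLA hAC, hδ]
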